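/- **Setting.** Let $\mathrm{Types}$ be a finite type hierarchy, i.e. a finite bounded complete partial order $\sqsubseteq$ in which $\bot=\bigsqcup\emptyset$ and $\top=\bigsqcup\mathrm{Types}$ exist (equivalently, a finite complete lattice), $\mathrm{Feats}$ a finite set of features, $\mathrm{Nodes}$ a set of nodes with a typing function $\theta:\mathrm{Nodes}\to\mathrm{Types}$, and $\mathrm{Words}$ a set of words. Paths are finite sequences of features. *Structures.* A multi-rooted structure (MRS) is a finite graph on a set of nodes with a partial arc function $\delta$ (at most one arc per node and feature) and a repetition-free list of roots from which every node is reachable; its length is the number of roots. A typed feature structure (TFS) is an MRS of length $1$. An abstract multi-rooted structure (AMRS) is $A=\langle \{1,\dots,k\},\Pi,\Theta,\approx\rangle$, with $\Pi$ a set of indexed paths $(i,\pi)$, $1\le i\le k$, in which every index occurs, $\Theta:\Pi\to\mathrm{Types}$, and $\approx$ an equivalence relation on $\Pi$ of finite index with $\Theta$ constant on classes, such that $\Pi$ is prefix-closed and fusion-closed: if $(i,\pi\alpha),(i',\pi'\alpha')\in\Pi$ and $(i,\pi)\approx(i',\pi')$, then $(i,\pi\alpha'),(i',\pi'\alpha)\in\Pi$,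 $(i,\pi\alpha')\approx(i',\pi'\alpha')$ and $(i',\pi'\alpha)\approx(i,\pi\alpha)$. Its length is $len(A)=k$; $\lambda$ is the AMRS of length $0$. $\mathrm{Abs}(\sigma)$ is the AMRS of an MRS $\sigma$: its indexed paths are the paths defined from the respective roots, typed by the node they reach, and equivalent iff they reach the same node. $A\sqsubseteq B$ means: same length, $\Pi_A\subseteq\Pi_B$, $\approx_A\subseteq\approx_B$ and $\Theta_A\sqsubseteq\Theta_B$ on $\Pi_A$. $A^{j\dots k}$ is the restriction of $A$ to the indices $j,\dots,k$ (renumbered), $A^j=A^{j\dots j}$, and $A\cdot B$ is concatenation, with no sharing between the two parts. *Unification.* For a set $J$ of indices of $A$, $(A,J)\sqcup B$ matches each element $i\in J$ of $A$ with an element $f(i)$ of $B$ ($f$ the identity, or $f(i)=1$ if $J$ is a singleton and $B$ has length $1$; for $B=B_0^{p\dots q}$ matched with a block of $A$, the order-preserving matching). Join the two sets of paths, the two relations, and (where both are defined) the types; take the least prefix- and fusion-closed extension (new paths get type $\bot$); extend $\approx$ to the generated equivalence relation; and give each path the join of the types in its class. It fails if some path then has type $\top$. Wherever a unification is used below, it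 is required not to fail. $A$ and $B$ of the same length are unifiable if $(A,\{1,\dots,len(A)\})\sqcup B$ does not fail. *Grammars and languages.* A grammar $G=(\mathcal R,A_s)$ is a finite set $\mathcal R$ of rules (MRSs of positive length, whose last element is the head and whose other elements are the body) and a TFS $A_s$, the start symbol. A lexicon assigns a set $Cat(x)$ of TFSs to each word $x$. For $w=w_1\cdots w_n$, $PT_w(j,k)$ is the set of all $\mathrm{Abs}(A_j)\cdots\mathrm{Abs}(A_k)$ with $A_i\in Cat(w_i)$ (and $\{\lambda\}$ if $j>k$). $A\to B$ (strong derivation) iff there are $\rho\in\mathcal R$, an AMRS $R\sqsupseteq\mathrm{Abs}(\rho)$ of length $n$, an index $j$ of $A$, and a block $i,\dots,i+n-2$ of indices of $B$ (empty if $n=1$) with $$A=(A,\{j\})\sqcup R^n,\quad R=(R,\{n\})\sqcup A^j,\quad B=(B,\{i,\dots,i+n-2\})\sqcup R^{1\dots n-1},\quad R=(R,\{1,\dots,n-1\})\sqcup B^{i\dots i+n-2},$$ and $B$ is obtained from $A$ by replacing its $j$-th element with the body of $R$, where paths keep their types and equivalences from $A$ and from $R$, and in addition a path $(i_1,\pi_1)$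 of $A$ and a path $(i_2,\pi_2)$ of the body of $R$ become equivalent if $(i_1,\pi_1)\approx_A(j,\pi_3)$ and $(n,\pi_3)\approx_R(i_2,\pi_2)$ for some $\pi_3$ (followed by the closure operations above). $\stackrel{*}{\to}$ is the reflexive transitive closure. $A\leadsto B$ iff there are $A',B'$ with $len(A')=len(A)$, $A$ and $A'$ unifiable, $B\sqsubseteq B'$ and $A'\stackrel{*}{\to}B'$. The language is $L(G)=\{w=w_1\cdots w_n : \mathrm{Abs}(A_s)\leadsto B\text{ for some }B\in PT_w(1,n)\}$. *Computations.* An item is $[i,A,j,c]$ with $i\le j$, $A$ an AMRS and $c\in\{\mathrm{Act},\mathrm{Comp}\}$. For $w=w_1\cdots w_n$, $T_{G,w}(I)$ consists of the following items: 1. $[i_\alpha,C^{1\dots k+1},j_\beta,\mathrm{Act}]$, where $R=\mathrm{Abs}(\rho)$ for some $\rho\in\mathcal R$ of length $m>1$, $k<m-1$, $[i_\alpha,A_\alpha,j_\alpha,\mathrm{Act}]\in I$ with $len(A_\alpha)=k$, $[i_\beta,A_\beta,j_\beta,\mathrm{Comp}]\in I$ with $len(A_\beta)=1$, $j_\alpha=i_\beta$,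 $B=(R,\{1,\dots,k\})\sqcup A_\alpha$ and $C=(B,\{k+1\})\sqcup A_\beta$; 2. $[i_\alpha,C^m,j_\alpha,\mathrm{Comp}]$, where $R=\mathrm{Abs}(\rho)$ for some $\rho\in\mathcal R$ of length $m>1$, $[i_\alpha,A_\alpha,j_\alpha,\mathrm{Act}]\in I$ with $len(A_\alpha)=m-1$ and $C=(R,\{1,\dots,m-1\})\sqcup A_\alpha$; 3. $[i,\lambda,i,\mathrm{Act}]$ for $0\le i\le n$; 4. $[i,\mathrm{Abs}(\rho),i,\mathrm{Comp}]$ for $\rho\in\mathcal R$ of length $1$ and $0\le i\le n$; 5. $[i-1,\mathrm{Abs}(A_i),i,\mathrm{Comp}]$ for $0<i\le n$ and $A_i\in Cat(w_i)$. The $w$-computation is $I_0=\emptyset$, $I_{m+1}=T_{G,w}(I_m)$. It is successful if for some $m$ there is an item $[0,A,n,\mathrm{Comp}]\in I_m$ such that $len(A)=1$ and $A$ is unifiable with $\mathrm{Abs}(A_s)$. **Theorem.** For every grammar $G$, every lexicon and every $w\in\mathrm{Words}^*$ (the empty word included): if the $w$-computation is successful, then $w\in L(G)$. -/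

import Mathlib

/-- The extension of a partial arc function `δ` from features to paths. -/
def runPath {Node Feat : Type*} (δ : Node → Feat → Option Node) :
    Node → List Feat → Option Node
  | q, [] => some q
  | q, f :: π => (δ q f).bind fun q' => runPath δ q' π

/-- Multi-rooted feature structures. The arc function is undefined (`none`) outside `Q`. -/
structure MRS (Node Feat : Type*) where
  Q : Set Node
  finite_Q : Q.Finite
  δ : Node → Feat → Option Node
  δ_mem : ∀ q f q', δ q f = some q' → q ∈ Q ∧ q' ∈ Q
  roots : List Node
  nodup : roots.Nodup
  roots_mem : ∀ r ∈ roots, r ∈ Q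
  reach : ∀ q ∈ Q, ∃ r ∈ roots, ∃ π, runPath δ r π = some q

/-- Typed feature structures `(Q, q̄, δ)`; the types come from a typing function on nodes. -/
structure TFS (Node Feat : Type*) where
  Q : Set Node
  finite_Q : Q.Finite
  root : Node
  root_mem : root ∈ Q
  δ : Node → Feat → Option Node
  δ_mem : ∀ q f q', δ q f = some q' → q ∈ Q ∧ q' ∈ Q
  reach : ∀ q ∈ Q, ∃ π, runPath δ root π = some q

/-- A feature structure, seen as a multi-rooted structure of length one. -/
def TFS.toMRS {Node Feat : Type*} (A : TFS Node Feat) : MRS Node Feat where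
  Q := A.Q
  finite_Q := A.finite_Q
  δ := A.δ
  δ_mem := A.δ_mem
  roots := [A.root]
  nodup := by simp
  roots_mem := by simpa using A.root_mem
  reach := by simpa using A.reach

/-- Indexed paths. Indices are counted from `0`. -/
abbrev IPath (Feat : Type*) := ℕ × List Feat

def PrefixClosed {Feat : Type*} (P : Set (IPath Feat)) : Prop :=
  ∀ i π α, (i, π ++ α) ∈ P → (i, π) ∈ P

def FusionClosed {Feat : Type*} (P : Set (IPath Feat)) (r : IPath Feat → IPath Feat → Prop) :
    Prop :=
  ∀ i π α i' π' α', (i, π ++ α) ∈ P → (i', π' ++ α') ∈ P → r (i, π) (i', π') →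
    (i, π ++ α') ∈ P ∧ (i', π' ++ α) ∈ P ∧
      r (i, π ++ α') (i', π' ++ α') ∧ r (i', π' ++ α) (i, π ++ α)

/-- Pre-abstract multi-rooted structures `⟨Ind, Π, Θ, ≈⟩` with `Ind = {0, …, len - 1}`.
`Θ` is a total function on `Π`; it is stored as a function on all indexed paths with the fixed
value `⊥` outside `Π`, so that equality of structures is equality of the four components. -/
structure PreAMRS (Feat Ty : Type*) [CompleteLattice Ty] where
  len : ℕ
  paths : Set (IPath Feat)
  typ : IPath Feat → Ty
  rel : IPath Feat → IPath Feat → Prop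
  idx_lt : ∀ p ∈ paths, p.1 < len
  idx_mem : ∀ i < len, ∃ π, (i, π) ∈ paths
  rel_mem : ∀ p q, rel p q → p ∈ paths ∧ q ∈ paths
  typ_bot : ∀ p, p ∉ paths → typ p = ⊥

/-- Abstract multi-rooted structures. An abstract feature structure is one of length one. -/
structure AMRS (Feat Ty : Type*) [CompleteLattice Ty] extends PreAMRS Feat Ty where
  prefixClosed : PrefixClosed paths
  fusionClosed : FusionClosed paths rel
  refl : ∀ p ∈ paths, rel p p
  symm : ∀ p q, rel p q → rel q p
  trans : ∀ p q s, rel p q → rel q s → rel p s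
  finite_index : {c : Set (IPath Feat) | ∃ p ∈ paths, c = {q | rel p q}}.Finite
  typ_rel : ∀ p q, rel p q → typ p = typ q

section Closure

variable {Feat Ty : Type*} [CompleteLattice Ty]

/-- `(P, r)` extends the paths and the relation of `C` and is prefix- and fusion-closed. -/
structure PreAMRS.ClosedExt (C : PreAMRS Feat Ty) (P : Set (IPath Feat))
    (r : IPath Feat → IPath Feat → Prop) : Prop where
  paths_sub : C.paths ⊆ P
  rel_sub : ∀ p q, C.rel p q → r p q
  rel_mem : ∀ p q, r p q → p ∈ P ∧ q ∈ P
  pre : PrefixClosed P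
  fus : FusionClosed P r

/-- `Cl`: the least prefix- and fusion-closed extension; paths that are added get the least
type `⊥`. -/
def PreAMRS.cl (C : PreAMRS Feat Ty) : PreAMRS Feat Ty where
  len := C.len
  paths := {p | ∀ P r, C.ClosedExt P r → p ∈ P}
  typ := C.typ
  rel := fun p q => ∀ P r, C.ClosedExt P r → r p q
  idx_lt := by
    intro p hp
    refine hp {p | p.1 < C.len} (fun p q => p.1 < C.len ∧ q.1 < C.len)
      ⟨C.idx_lt, ?_, fun _ _ h => h, ?_, ?_⟩
    · exact fun p q h => ⟨C.idx_lt _ (C.rel_mem _ _ h).1, C.idx_lt _ (C.rel_mem _ _ h).2⟩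
    · exact fun i π α h => h
    · exact fun i π α i' π' α' h h' _ => ⟨h, h', ⟨h, h'⟩, ⟨h', h⟩⟩
  idx_mem := by
    intro i hi
    obtain ⟨π, h⟩ := C.idx_mem i hi
    exact ⟨π, fun P r hP => hP.paths_sub h⟩
  rel_mem := fun p q h =>
    ⟨fun P r hP => (hP.rel_mem _ _ (h P r hP)).1, fun P r hP => (hP.rel_mem _ _ (h P r hP)).2⟩
  typ_bot := fun p hp => C.typ_bot p fun h => hp fun P r hP => hP.paths_sub h

/-- `Eq`: the least extension of `≈` to an equivalence relation on the paths. -/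
def PreAMRS.eqv (C : PreAMRS Feat Ty) : PreAMRS Feat Ty where
  len := C.len
  paths := C.paths
  typ := C.typ
  rel := fun p q => p ∈ C.paths ∧ q ∈ C.paths ∧ Relation.EqvGen C.rel p q
  idx_lt := C.idx_lt
  idx_mem := C.idx_mem
  rel_mem := fun _ _ h => ⟨h.1, h.2.1⟩
  typ_bot := C.typ_bot

/-- `Ty`: every path gets the join of the types of all paths related to it. -/
def PreAMRS.ty (C : PreAMRS Feat Ty) : PreAMRS Feat Ty where
  len := C.len
  paths := C.paths
  typ := fun p => ⨆ q ∈ {q | C.rel p q}, C.typ q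
  rel := C.rel
  idx_lt := C.idx_lt
  idx_mem := C.idx_mem
  rel_mem := C.rel_mem
  typ_bot := by
    intro p hp
    simp only [iSup_eq_bot]
    exact fun q h => absurd (C.rel_mem _ _ h).1 hp

/-- Up to the equivalence generated by `≈` there are finitely many paths. -/
def PreAMRS.FiniteCover (C : PreAMRS Feat Ty) : Prop :=
  ∃ S : Set (IPath Feat), S.Finite ∧ ∀ p ∈ C.paths, ∃ s ∈ S, Relation.EqvGen C.rel p s

theorem PreAMRS.finiteCover_of_map (C : PreAMRS Feat Ty) {X : Type*} (h : IPath Feat → X)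
    (hfin : (h '' C.paths).Finite)
    (hh : ∀ p ∈ C.paths, ∀ q ∈ C.paths, h p = h q → C.rel p q) : C.FiniteCover := by
  obtain ⟨S, hS, hb⟩ := Set.exists_subset_bijOn C.paths h
  refine ⟨S, hb.finite_iff_finite.2 hfin, fun p hp => ?_⟩
  have : h p ∈ h '' S := hb.image_eq ▸ ⟨p, hp, rfl⟩
  obtain ⟨s, hs, hsp⟩ := this
  exact ⟨s, hs, .rel _ _ (hh p hp s (hS hs) hsp.symm)⟩

theorem PreAMRS.cl_closedExt (C : PreAMRS Feat Ty) : C.ClosedExt C.cl.paths C.cl.rel where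
  paths_sub := fun _ hp _ _ h => h.paths_sub hp
  rel_sub := fun _ _ hp _ _ h => h.rel_sub _ _ hp
  rel_mem := C.cl.rel_mem
  pre := fun _ _ _ hp P r h => h.pre _ _ _ (hp P r h)
  fus := fun i π α i' π' α' h1 h2 h3 =>
    ⟨fun P r h => (h.fus i π α i' π' α' (h1 P r h) (h2 P r h) (h3 P r h)).1,
      fun P r h => (h.fus i π α i' π' α' (h1 P r h) (h2 P r h) (h3 P r h)).2.1,
      fun P r h => (h.fus i π α i' π' α' (h1 P r h) (h2 P r h) (h3 P r h)).2.2.1,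
      fun P r h => (h.fus i π α i' π' α' (h1 P r h) (h2 P r h) (h3 P r h)).2.2.2⟩

theorem eqvGen_append {P : Set (IPath Feat)} {r : IPath Feat → IPath Feat → Prop}
    (hm : ∀ p q, r p q → p ∈ P ∧ q ∈ P) (hf : FusionClosed P r) {p q : IPath Feat}
    (h : Relation.EqvGen r p q) (α : List Feat) :
    ((p.1, p.2 ++ α) ∈ P ↔ (q.1, q.2 ++ α) ∈ P) ∧
      ((p.1, p.2 ++ α) ∈ P → Relation.EqvGen r (p.1, p.2 ++ α) (q.1, q.2 ++ α)) := by
  induction h with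
  | rel p q h =>
    obtain ⟨hp, hq⟩ := hm _ _ h
    have h1 : (p.1, p.2 ++ α) ∈ P → _ := fun h' =>
      hf p.1 p.2 α q.1 q.2 [] h' (by simpa using hq) h
    have h2 : (q.1, q.2 ++ α) ∈ P → _ := fun h' =>
      hf p.1 p.2 [] q.1 q.2 α (by simpa using hp) h' h
    exact ⟨⟨fun h' => (h1 h').2.1, fun h' => (h2 h').1⟩,
      fun h' => .symm _ _ (.rel _ _ (h1 h').2.2.2)⟩
  | refl p => exact ⟨Iff.rfl, fun _ => .refl _⟩
  | symm p q _ ih => exact ⟨ih.1.symm, fun h' => .symm _ _ (ih.2 (ih.1.2 h'))⟩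
  | trans p q s _ _ ih1 ih2 =>
    exact ⟨ih1.1.trans ih2.1, fun h' => .trans _ _ _ (ih1.2 h') (ih2.2 (ih1.1.1 h'))⟩

theorem PreAMRS.cl_cover (C : PreAMRS Feat Ty) (hp : PrefixClosed C.paths) {p : IPath Feat}
    (h : p ∈ C.cl.paths) : ∃ p0 ∈ C.paths, Relation.EqvGen C.cl.rel p p0 := by
  let good : IPath Feat → Prop := fun p => ∃ p0 ∈ C.paths, Relation.EqvGen C.cl.rel p p0
  let P : Set (IPath Feat) :=
    {p | p ∈ C.cl.paths ∧ ∀ π α, p.2 = π ++ α → good (p.1, π)}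
  have hcl := C.cl_closedExt
  have key : C.ClosedExt P (fun p q => C.cl.rel p q ∧ p ∈ P ∧ q ∈ P) := by
    have hCP : C.paths ⊆ P := fun p hpp => ⟨hcl.paths_sub hpp, fun π α e =>
      ⟨(p.1, π), hp p.1 π α (by rw [← e]; exact hpp), .refl _⟩⟩
    have half : ∀ i π α i' π' α', (i, π ++ α) ∈ P → (i', π' ++ α') ∈ P →
        C.cl.rel (i, π) (i', π') → (i, π ++ α') ∈ P := by
      intro i π α i' π' α' h1 h2 h3
      refine ⟨(hcl.fus i π α i' π' α' h1.1 h2.1 h3).1, ?_⟩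
      intro ρ β e
      rcases List.append_eq_append_iff.1 e with ⟨a, rfl, e2⟩ | ⟨a, rfl, e2⟩
      · have hmem : (i', π' ++ a) ∈ C.cl.paths :=
          hcl.pre i' (π' ++ a) β (by rw [List.append_assoc, ← e2]; exact h2.1)
        obtain ⟨p0, hp0, hr⟩ := h2.2 (π' ++ a) β (by rw [List.append_assoc, ← e2])
        exact ⟨p0, hp0, .trans _ _ _
          (.rel _ _ (hcl.fus i π α i' π' a h1.1 hmem h3).2.2.1) hr⟩
      · exact h1.2 ρ (a ++ α) (by simp)
    have half' : ∀ i π α i' π' α', (i, π ++ α) ∈ P → (i', π' ++ α') ∈ P →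
        C.cl.rel (i, π) (i', π') → (i', π' ++ α) ∈ P := by
      intro i π α i' π' α' h1 h2 h3
      refine ⟨(hcl.fus i π α i' π' α' h1.1 h2.1 h3).2.1, ?_⟩
      intro ρ β e
      rcases List.append_eq_append_iff.1 e with ⟨a, rfl, e2⟩ | ⟨a, rfl, e2⟩
      · have hmem : (i, π ++ a) ∈ C.cl.paths :=
          hcl.pre i (π ++ a) β (by rw [List.append_assoc, ← e2]; exact h1.1)
        obtain ⟨p0, hp0, hr⟩ := h1.2 (π ++ a) β (by rw [List.append_assoc, ← e2])
        exact ⟨p0, hp0, .trans _ _ _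
          (.rel _ _ (hcl.fus i π a i' π' α' hmem h2.1 h3).2.2.2) hr⟩
      · exact h2.2 ρ (a ++ α') (by simp)
    refine ⟨hCP, ?_, fun _ _ h => h.2, ?_, ?_⟩
    · exact fun p q h => ⟨hcl.rel_sub _ _ h, hCP (C.rel_mem _ _ h).1, hCP (C.rel_mem _ _ h).2⟩
    · exact fun i π α h => ⟨hcl.pre i π α h.1, fun ρ β e =>
        h.2 ρ (β ++ α) (by simp only at e; rw [e, List.append_assoc])⟩
    · intro i π α i' π' α' h1 h2 h3
      have a1 := half i π α i' π' α' h1 h2 h3.1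
      have a2 := half' i π α i' π' α' h1 h2 h3.1
      obtain ⟨-, -, b3, b4⟩ := hcl.fus i π α i' π' α' h1.1 h2.1 h3.1
      exact ⟨a1, a2, ⟨b3, a1, h2⟩, ⟨b4, a2, h1⟩⟩
  exact (h _ _ key).2 p.2 [] (by simp)

/-- The closure `Ty (Eq (Cl C))`, which is an abstract multi-rooted structure. -/
def PreAMRS.close (C : PreAMRS Feat Ty) (hp : PrefixClosed C.paths) (hf : C.FiniteCover) :
    AMRS Feat Ty where
  toPreAMRS := C.cl.eqv.ty
  prefixClosed := C.cl_closedExt.pre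
  fusionClosed := by
    rintro i π α i' π' α' h1 h2 ⟨h3, h4, h5⟩
    have a := eqvGen_append C.cl.rel_mem C.cl_closedExt.fus h5 α
    have a' := eqvGen_append C.cl.rel_mem C.cl_closedExt.fus h5 α'
    exact ⟨a'.1.2 h2, a.1.1 h1, ⟨a'.1.2 h2, h2, a'.2 (a'.1.2 h2)⟩,
      ⟨a.1.1 h1, h1, .symm _ _ (a.2 h1)⟩⟩
  refl := fun p h => ⟨h, h, .refl _⟩
  symm := fun p q h => ⟨h.2.1, h.1, .symm _ _ h.2.2⟩
  trans := fun p q s h h' => ⟨h.1, h'.2.1, .trans _ _ _ h.2.2 h'.2.2⟩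
  finite_index := by
    obtain ⟨S, hS, hc⟩ := hf
    refine (hS.image fun s => {q | q ∈ C.cl.paths ∧ Relation.EqvGen C.cl.rel s q}).subset ?_
    rintro c ⟨p, hpp, rfl⟩
    obtain ⟨p0, hp0, hr⟩ := C.cl_cover hp hpp
    obtain ⟨s, hs, hr'⟩ := hc p0 hp0
    have hr' := hr'.mono (fun p q h => C.cl_closedExt.rel_sub p q h)
    refine ⟨s, hs, Set.ext fun q => ⟨fun h => ⟨hpp, h.1, ?_⟩, fun h => ⟨h.2.1, ?_⟩⟩⟩
    · exact .trans _ _ _ (.trans _ _ _ hr hr') h.2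
    · exact .trans _ _ _ (.symm _ _ (.trans _ _ _ hr hr')) h.2.2
  typ_rel := by
    intro p q h
    have e : {s | C.cl.eqv.rel p s} = {s | C.cl.eqv.rel q s} := Set.ext fun s =>
      ⟨fun h' => ⟨h.2.1, h'.2.1, .trans _ _ _ (.symm _ _ h.2.2) h'.2.2⟩,
        fun h' => ⟨h.1, h'.2.1, .trans _ _ _ h.2.2 h'.2.2⟩⟩
    show (⨆ s ∈ {s | C.cl.eqv.rel p s}, _) = ⨆ s ∈ {s | C.cl.eqv.rel q s}, _
    rw [e]

theorem finite_index_of_map {P : Set (IPath Feat)} {r : IPath Feat → IPath Feat → Prop}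
    (hs : ∀ p q, r p q → r q p) (ht : ∀ p q s, r p q → r q s → r p s)
    {X : Type*} (h : IPath Feat → X) (hfin : (h '' P).Finite)
    (hh : ∀ p ∈ P, ∀ q ∈ P, h p = h q → r p q) :
    {c : Set (IPath Feat) | ∃ p ∈ P, c = {q | r p q}}.Finite := by
  obtain ⟨S, hS, hb⟩ := Set.exists_subset_bijOn P h
  refine ((hb.finite_iff_finite.2 hfin).image fun s => {q | r s q}).subset ?_
  rintro c ⟨p, hp, rfl⟩
  have : h p ∈ h '' S := hb.image_eq ▸ ⟨p, hp, rfl⟩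
  obtain ⟨s, hs', hsp⟩ := this
  have hr := hh p hp s (hS hs') hsp.symm
  exact ⟨s, hs', Set.ext fun q => ⟨fun h => ht _ _ _ hr h, fun h => ht _ _ _ (hs _ _ hr) h⟩⟩

theorem AMRS.finite_range_class (A : AMRS Feat Ty) :
    (Set.range fun p => {q | A.rel p q}).Finite := by
  refine (A.finite_index.union (Set.finite_singleton ∅)).subset ?_
  rintro c ⟨p, rfl⟩
  by_cases hp : p ∈ A.paths
  · exact .inl ⟨p, hp, rfl⟩
  · exact .inr (Set.eq_empty_iff_forall_notMem.2 fun q h => hp (A.rel_mem _ _ h).1)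

theorem AMRS.rel_of_class_eq (A : AMRS Feat Ty) {p q : IPath Feat} (hq : q ∈ A.paths)
    (h : {s | A.rel p s} = {s | A.rel q s}) : A.rel p q := by
  have : q ∈ {s | A.rel q s} := A.refl q hq
  rw [← h] at this
  exact this

end Closure

section Abstraction

variable {Node Feat Ty : Type*} [CompleteLattice Ty]

/-- The node reached from the root with the given index along the given path, if any. -/
def MRS.node (σ : MRS Node Feat) (p : IPath Feat) : Option Node :=
  (σ.roots[p.1]?).bind fun r => runPath σ.δ r p.2

theorem runPath_append (δ : Node → Feat → Option Node) (q : Node) (π α : List Feat) :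
    runPath δ q (π ++ α) = (runPath δ q π).bind fun q' => runPath δ q' α := by
  induction π generalizing q with
  | nil => rfl
  | cons f π ih => cases h : δ q f <;> simp [runPath, h, ih]

theorem MRS.node_append (σ : MRS Node Feat) (i : ℕ) (π α : List Feat) :
    σ.node (i, π ++ α) = (σ.node (i, π)).bind fun q' => runPath σ.δ q' α := by
  cases h : σ.roots[i]? <;> simp [MRS.node, h, runPath_append]

theorem MRS.node_mem (σ : MRS Node Feat) {p : IPath Feat} {q : Node} (h : σ.node p = some q) :
    q ∈ σ.Q := by
  have aux : ∀ π : List Feat, ∀ r ∈ σ.Q, ∀ q, runPath σ.δ r π = some q → q ∈ σ.Q := by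
    intro π
    induction π with
    | nil => rintro r hr q h; simp only [runPath, Option.some.injEq] at h; exact h ▸ hr
    | cons f π ih =>
      rintro r hr q h
      simp only [runPath, Option.bind_eq_some_iff] at h
      obtain ⟨q', h1, h2⟩ := h
      exact ih q' (σ.δ_mem _ _ _ h1).2 q h2
  simp only [MRS.node, Option.bind_eq_some_iff] at h
  obtain ⟨r, hr, h⟩ := h
  exact aux _ r (σ.roots_mem r (List.mem_of_getElem? hr)) q h

/-- The abstraction of a multi-rooted structure; `θ` assigns types to nodes. -/
def MRS.abs (θ : Node → Ty) (σ : MRS Node Feat) : AMRS Feat Ty where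
  len := σ.roots.length
  paths := {p | ∃ q, σ.node p = some q}
  typ := fun p => ((σ.node p).map θ).getD ⊥
  rel := fun p p' => ∃ q, σ.node p = some q ∧ σ.node p' = some q
  idx_lt := by
    rintro ⟨i, π⟩ ⟨q, h⟩
    simp only [MRS.node, Option.bind_eq_some_iff] at h
    obtain ⟨r, hr, -⟩ := h
    exact (List.getElem?_eq_some_iff.1 hr).1
  idx_mem := fun i hi => ⟨[], σ.roots[i], by simp [MRS.node, hi, runPath]⟩
  rel_mem := fun p p' ⟨q, h, h'⟩ => ⟨⟨q, h⟩, ⟨q, h'⟩⟩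
  typ_bot := by
    intro p hp
    cases h : σ.node p with
    | none => rfl
    | some q => exact absurd ⟨q, h⟩ hp
  prefixClosed := by
    rintro i π α ⟨q, h⟩
    rw [MRS.node_append, Option.bind_eq_some_iff] at h
    exact ⟨h.choose, h.choose_spec.1⟩
  fusionClosed := by
    rintro i π α i' π' α' ⟨q, h⟩ ⟨q', h'⟩ ⟨x, hx, hx'⟩
    have e : ∀ β, σ.node (i, π ++ β) = σ.node (i', π' ++ β) := fun β => by
      rw [MRS.node_append, MRS.node_append, hx, hx']
    exact ⟨⟨q', by rw [e, h']⟩, ⟨q, by rw [← e, h]⟩, ⟨q', by rw [e, h'], h'⟩,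
      ⟨q, by rw [← e, h], h⟩⟩
  refl := fun p ⟨q, h⟩ => ⟨q, h, h⟩
  symm := fun p p' ⟨q, h, h'⟩ => ⟨q, h', h⟩
  trans := by
    rintro p q s ⟨x, h1, h2⟩ ⟨y, h3, h4⟩
    rw [h2] at h3
    exact ⟨x, h1, by rw [h4, h3]⟩
  finite_index := by
    refine finite_index_of_map ?_ ?_ σ.node
      ((σ.finite_Q.image some).subset ?_) ?_
    · exact fun p p' ⟨q, h, h'⟩ => ⟨q, h', h⟩
    · rintro p q s ⟨x, h1, h2⟩ ⟨y, h3, h4⟩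
      rw [h2] at h3
      exact ⟨x, h1, by rw [h4, h3]⟩
    · rintro _ ⟨p, ⟨q, h⟩, rfl⟩
      exact ⟨q, σ.node_mem h, h.symm⟩
    · rintro p ⟨q, h⟩ p' - e
      exact ⟨q, h, by rw [← e, h]⟩
  typ_rel := by
    rintro p p' ⟨q, h, h'⟩
    simp only [h, h']

/-- The abstraction of a feature structure. -/
def TFS.abs (θ : Node → Ty) (A : TFS Node Feat) : AMRS Feat Ty := A.toMRS.abs θ

end Abstraction

section Operations

variable {Feat Ty : Type*} [CompleteLattice Ty]

/-- Subsumption: `A ≤ B` says that `A` is more general than `B`. -/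
instance : LE (AMRS Feat Ty) where
  le A B := A.len = B.len ∧ A.paths ⊆ B.paths ∧ (∀ p q, A.rel p q → B.rel p q) ∧
    ∀ p ∈ A.paths, A.typ p ≤ B.typ p

/-- The empty structure `λ`. -/
def AMRS.empty : AMRS Feat Ty where
  len := 0
  paths := ∅
  typ := fun _ => ⊥
  rel := fun _ _ => False
  idx_lt := fun _ h => h.elim
  idx_mem := fun _ h => absurd h (Nat.not_lt_zero _)
  rel_mem := fun _ _ h => h.elim
  typ_bot := fun _ _ => rfl
  prefixClosed := fun _ _ _ h => h
  fusionClosed := fun _ _ _ _ _ _ h _ _ => h.elim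
  refl := fun _ h => h.elim
  symm := fun _ _ h => h
  trans := fun _ _ _ h _ => h
  finite_index := by simp
  typ_rel := fun _ _ h => h.elim

open Classical in
/-- The sub-structure induced by the `l` consecutive indices `m, …, m + l - 1`, renumbered so as
to start from `0`. -/
noncomputable def AMRS.slice (A : AMRS Feat Ty) (m l : ℕ) : AMRS Feat Ty where
  len := min l (A.len - m)
  paths := {p | p.1 < l ∧ (m + p.1, p.2) ∈ A.paths}
  typ := fun p => if p.1 < l then A.typ (m + p.1, p.2) else ⊥
  rel := fun p q => p.1 < l ∧ q.1 < l ∧ A.rel (m + p.1, p.2) (m + q.1, q.2)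
  idx_lt := by
    rintro p ⟨h, h'⟩
    have := A.idx_lt _ h'
    simp only at this
    omega
  idx_mem := by
    intro i hi
    obtain ⟨π, h⟩ := A.idx_mem (m + i) (by omega)
    exact ⟨π, by omega, h⟩
  rel_mem := fun p q h => ⟨⟨h.1, (A.rel_mem _ _ h.2.2).1⟩, ⟨h.2.1, (A.rel_mem _ _ h.2.2).2⟩⟩
  typ_bot := by
    intro p hp
    split_ifs with h
    · exact A.typ_bot _ fun h' => hp ⟨h, h'⟩
    · rfl
  prefixClosed := fun i π α h => ⟨h.1, A.prefixClosed _ _ _ h.2⟩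
  fusionClosed := by
    intro i π α i' π' α' h1 h2 h3
    obtain ⟨a, b, c, d⟩ := A.fusionClosed _ _ _ _ _ _ h1.2 h2.2 h3.2.2
    exact ⟨⟨h1.1, a⟩, ⟨h2.1, b⟩, ⟨h1.1, h2.1, c⟩, ⟨h2.1, h1.1, d⟩⟩
  refl := fun p h => ⟨h.1, h.1, A.refl _ h.2⟩
  symm := fun p q h => ⟨h.2.1, h.1, A.symm _ _ h.2.2⟩
  trans := fun p q s h h' => ⟨h.1, h'.2.1, A.trans _ _ _ h.2.2 h'.2.2⟩
  finite_index := by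
    refine finite_index_of_map (fun p q h => ⟨h.2.1, h.1, A.symm _ _ h.2.2⟩)
      (fun p q s h h' => ⟨h.1, h'.2.1, A.trans _ _ _ h.2.2 h'.2.2⟩)
      (fun p => {q | A.rel (m + p.1, p.2) q}) (A.finite_range_class.subset ?_) ?_
    · rintro _ ⟨p, -, rfl⟩
      exact ⟨_, rfl⟩
    · exact fun p hp q hq e => ⟨hp.1, hq.1, A.rel_of_class_eq hq.2 e⟩
  typ_rel := by
    rintro p q ⟨h1, h2, h3⟩
    simp only [h1, h2, if_true]
    exact A.typ_rel _ _ h3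

open Classical in
/-- Concatenation. -/
noncomputable def AMRS.concat (A B : AMRS Feat Ty) : AMRS Feat Ty where
  len := A.len + B.len
  paths := {p | p ∈ A.paths ∨ A.len ≤ p.1 ∧ (p.1 - A.len, p.2) ∈ B.paths}
  typ := fun p => if p.1 < A.len then A.typ p else B.typ (p.1 - A.len, p.2)
  rel := fun p q => A.rel p q ∨
    A.len ≤ p.1 ∧ A.len ≤ q.1 ∧ B.rel (p.1 - A.len, p.2) (q.1 - A.len, q.2)
  idx_lt := by
    rintro p (h | ⟨h, h'⟩)
    · exact Nat.lt_add_right _ (A.idx_lt p h)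
    · have := B.idx_lt _ h'
      simp only at this
      omega
  idx_mem := by
    intro i hi
    by_cases h : i < A.len
    · obtain ⟨π, h'⟩ := A.idx_mem i h
      exact ⟨π, .inl h'⟩
    · obtain ⟨π, h'⟩ := B.idx_mem (i - A.len) (by omega)
      exact ⟨π, .inr ⟨by omega, h'⟩⟩
  rel_mem := by
    rintro p q (h | ⟨h1, h2, h3⟩)
    · exact ⟨.inl (A.rel_mem _ _ h).1, .inl (A.rel_mem _ _ h).2⟩
    · exact ⟨.inr ⟨h1, (B.rel_mem _ _ h3).1⟩, .inr ⟨h2, (B.rel_mem _ _ h3).2⟩⟩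
  typ_bot := by
    intro p hp
    split_ifs with h
    · exact A.typ_bot _ fun h' => hp (.inl h')
    · exact B.typ_bot _ fun h' => hp (.inr ⟨by omega, h'⟩)
  prefixClosed := by
    rintro i π α (h | ⟨h, h'⟩)
    · exact .inl (A.prefixClosed _ _ _ h)
    · exact .inr ⟨h, B.prefixClosed _ _ _ h'⟩
  fusionClosed := by
    rintro i π α i' π' α' h1 h2 (h | ⟨h, h', h''⟩)
    · have hi := A.idx_lt _ (A.rel_mem _ _ h).1
      have hi' := A.idx_lt _ (A.rel_mem _ _ h).2
      simp only at hi hi'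
      obtain ⟨a, b, c, d⟩ := A.fusionClosed _ _ _ _ _ _
        (h1.resolve_right fun h => absurd h.1 (by simp only; omega))
        (h2.resolve_right fun h => absurd h.1 (by simp only; omega)) h
      exact ⟨.inl a, .inl b, .inl c, .inl d⟩
    · simp only at h h'
      obtain ⟨a, b, c, d⟩ := B.fusionClosed _ _ _ _ _ _
        (h1.resolve_left fun h => absurd (A.idx_lt _ h) (by simp only; omega)).2
        (h2.resolve_left fun h => absurd (A.idx_lt _ h) (by simp only; omega)).2 h''
      exact ⟨.inr ⟨h, a⟩, .inr ⟨h', b⟩, .inr ⟨h, h', c⟩, .inr ⟨h', h, d⟩⟩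
  refl := by
    rintro p (h | ⟨h, h'⟩)
    · exact .inl (A.refl _ h)
    · exact .inr ⟨h, h, B.refl _ h'⟩
  symm := by
    rintro p q (h | ⟨h, h', h''⟩)
    · exact .inl (A.symm _ _ h)
    · exact .inr ⟨h', h, B.symm _ _ h''⟩
  trans := by
    rintro p q s (h | ⟨h1, h2, h3⟩) (h' | ⟨h1', h2', h3'⟩)
    · exact .inl (A.trans _ _ _ h h')
    · exact absurd (A.idx_lt _ (A.rel_mem _ _ h).2) (by omega)
    · exact absurd (A.idx_lt _ (A.rel_mem _ _ h').1) (by omega)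
    · exact .inr ⟨h1, h2', B.trans _ _ _ h3 h3'⟩
  finite_index := by
    refine ((A.finite_index).union ((B.finite_index).image
      fun c => {q | A.len ≤ q.1 ∧ (q.1 - A.len, q.2) ∈ c})).subset ?_
    rintro c ⟨p, h | ⟨h, h'⟩, rfl⟩
    · have hl := A.idx_lt _ h
      exact .inl ⟨p, h, Set.ext fun q =>
        ⟨fun h' => h'.resolve_right fun h'' => absurd h''.1 (by omega), fun h' => .inl h'⟩⟩
    · refine .inr ⟨_, ⟨_, h', rfl⟩, Set.ext fun q => ⟨fun h'' => .inr ⟨h, h''⟩, fun h'' => ?_⟩⟩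
      exact (h''.resolve_left fun h3 => absurd (A.idx_lt _ (A.rel_mem _ _ h3).1) (by omega)).2
  typ_rel := by
    rintro p q (h | ⟨h, h', h''⟩)
    · have hp := A.idx_lt _ (A.rel_mem _ _ h).1
      have hq := A.idx_lt _ (A.rel_mem _ _ h).2
      simp only [hp, hq, if_true]
      exact A.typ_rel _ _ h
    · rw [if_neg (by omega), if_neg (by omega)]
      exact B.typ_rel _ _ h''

open Classical in
/-- The structure whose closure is the unification of `(A, J)` with `B`, where element `i ∈ J`
of `A` is matched with element `f i` of `B`. Types are `⊥` outside the respective sets of paths,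
so the join below is the type in `A`, the type in `B`, or their join, according to which of the
two structures has the path. -/
noncomputable def AMRS.unifyPre (A : AMRS Feat Ty) (J : Set ℕ) (f : ℕ → ℕ) (B : AMRS Feat Ty) :
    PreAMRS Feat Ty where
  len := A.len
  paths := {p | p ∈ A.paths ∨ (p.1 < A.len ∧ p.1 ∈ J) ∧ (f p.1, p.2) ∈ B.paths}
  typ := fun p => if p.1 < A.len ∧ p.1 ∈ J then A.typ p ⊔ B.typ (f p.1, p.2) else A.typ p
  rel := fun p q => A.rel p q ∨ (p.1 < A.len ∧ p.1 ∈ J) ∧ (q.1 < A.len ∧ q.1 ∈ J) ∧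
    B.rel (f p.1, p.2) (f q.1, q.2)
  idx_lt := by
    rintro p (h | h)
    · exact A.idx_lt p h
    · exact h.1.1
  idx_mem := fun i hi => (A.idx_mem i hi).imp fun _ h => .inl h
  rel_mem := by
    rintro p q (h | ⟨h1, h2, h3⟩)
    · exact ⟨.inl (A.rel_mem _ _ h).1, .inl (A.rel_mem _ _ h).2⟩
    · exact ⟨.inr ⟨h1, (B.rel_mem _ _ h3).1⟩, .inr ⟨h2, (B.rel_mem _ _ h3).2⟩⟩
  typ_bot := by
    intro p hp
    split_ifs with h
    · rw [A.typ_bot _ fun h' => hp (.inl h'), B.typ_bot _ fun h' => hp (.inr ⟨h, h'⟩), bot_sup_eq]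
    · exact A.typ_bot _ fun h' => hp (.inl h')

theorem AMRS.unifyPre_prefixClosed (A : AMRS Feat Ty) (J : Set ℕ) (f : ℕ → ℕ)
    (B : AMRS Feat Ty) : PrefixClosed (A.unifyPre J f B).paths := by
  rintro i π α (h | ⟨h, h'⟩)
  · exact .inl (A.prefixClosed _ _ _ h)
  · exact .inr ⟨h, B.prefixClosed _ _ _ h'⟩

theorem AMRS.unifyPre_finiteCover (A : AMRS Feat Ty) (J : Set ℕ) (f : ℕ → ℕ)
    (B : AMRS Feat Ty) : (A.unifyPre J f B).FiniteCover := by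
  refine PreAMRS.finiteCover_of_map _
    (fun p => (p.1, {q | A.rel p q}, {q | B.rel (f p.1, p.2) q}))
    (((Set.finite_Iio A.len).prod (A.finite_range_class.prod B.finite_range_class)).subset ?_) ?_
  · rintro _ ⟨p, hp, rfl⟩
    exact ⟨(A.unifyPre J f B).idx_lt p hp, ⟨p, rfl⟩, ⟨_, rfl⟩⟩
  · intro p hp q hq e
    simp only [Prod.mk.injEq] at e
    obtain ⟨e1, e2, e3⟩ := e
    rcases hq with hq | ⟨hq, hq'⟩
    · exact .inl (A.rel_of_class_eq hq e2)
    · exact .inr ⟨e1 ▸ hq, hq, B.rel_of_class_eq hq' e3⟩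

/-- Unification in context, `(A, J) ⊔ B`, where element `i ∈ J` of `A` is matched with element
`f i` of `B`: `f = id` for the unification with a multi-rooted structure, and `f = 0` on the single
element of `J` for the unification with a feature structure. -/
noncomputable def AMRS.unify (A : AMRS Feat Ty) (J : Set ℕ) (f : ℕ → ℕ) (B : AMRS Feat Ty) :
    AMRS Feat Ty :=
  (A.unifyPre J f B).close (A.unifyPre_prefixClosed J f B) (A.unifyPre_finiteCover J f B)

/-- The inconsistent structures: some path has type `⊤`. -/
def AMRS.Fails (A : AMRS Feat Ty) : Prop := ∃ p ∈ A.paths, A.typ p = ⊤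

/-- The unification of `(A, J)` with `B` along `f` succeeds, and its result is `C`. -/
def AMRS.Unif (A : AMRS Feat Ty) (J : Set ℕ) (f : ℕ → ℕ) (B C : AMRS Feat Ty) : Prop :=
  C = A.unify J f B ∧ ¬ C.Fails

/-- The new index of element `i ≠ j` of `A` when element `j` is replaced by the body of a rule of
length `n`. -/
def outerIdx (j n i : ℕ) : ℕ := if i < j then i else i + n - 2

/-- The new index of element `i` of the body of a rule when the body replaces element `j`. -/
def bodyIdx (j i : ℕ) : ℕ := i + j

open Classical in
/-- The replacement of element `j` of `A` by the body of `R`, before taking closures. The head of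
`R` is its last element, with index `R.len - 1`. -/
noncomputable def AMRS.replacePre (A : AMRS Feat Ty) (j : ℕ) (R : AMRS Feat Ty) (hj : j < A.len)
    (hR : 0 < R.len) : PreAMRS Feat Ty where
  len := A.len + R.len - 2
  paths := {p |
    (∃ i, i ≠ j ∧ p.1 = outerIdx j R.len i ∧ (i, p.2) ∈ A.paths) ∨
    (∃ i, i < R.len - 1 ∧ p.1 = bodyIdx j i ∧ (i, p.2) ∈ R.paths)}
  typ := fun p =>
    if p.1 < j then A.typ p
    else if p.1 < j + (R.len - 1) then R.typ (p.1 - j, p.2)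
    else A.typ (p.1 + 2 - R.len, p.2)
  rel := fun p q =>
    (∃ i i', i ≠ j ∧ i' ≠ j ∧ p.1 = outerIdx j R.len i ∧ q.1 = outerIdx j R.len i' ∧
      A.rel (i, p.2) (i', q.2)) ∨
    (∃ i i', i < R.len - 1 ∧ i' < R.len - 1 ∧ p.1 = bodyIdx j i ∧ q.1 = bodyIdx j i' ∧
      R.rel (i, p.2) (i', q.2)) ∨
    (∃ i i' π, i ≠ j ∧ i' < R.len - 1 ∧ p.1 = outerIdx j R.len i ∧ q.1 = bodyIdx j i' ∧
      A.rel (i, p.2) (j, π) ∧ R.rel (R.len - 1, π) (i', q.2)) ∨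
    (∃ i i' π, i < R.len - 1 ∧ i' ≠ j ∧ p.1 = bodyIdx j i ∧ q.1 = outerIdx j R.len i' ∧
      R.rel (i, p.2) (R.len - 1, π) ∧ A.rel (j, π) (i', q.2))
  idx_lt := by
    rintro p (⟨i, h, e, h'⟩ | ⟨i, h, e, h'⟩)
    · have := A.idx_lt _ h'
      simp only at this
      rw [e, outerIdx]
      split_ifs <;> omega
    · rw [e, bodyIdx]
      omega
  idx_mem := by
    intro i hi
    by_cases h1 : i < j
    · obtain ⟨π, h⟩ := A.idx_mem i (by omega)
      exact ⟨π, .inl ⟨i, by omega, by simp [outerIdx, h1], h⟩⟩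
    · by_cases h2 : i < j + (R.len - 1)
      · obtain ⟨π, h⟩ := R.idx_mem (i - j) (by omega)
        exact ⟨π, .inr ⟨i - j, by omega, by simp only [bodyIdx]; omega, h⟩⟩
      · obtain ⟨π, h⟩ := A.idx_mem (i + 2 - R.len) (by omega)
        refine ⟨π, .inl ⟨i + 2 - R.len, by omega, ?_, h⟩⟩
        simp only [outerIdx]
        split_ifs <;> omega
  rel_mem := by
    rintro p q (⟨i, i', h1, h2, h3, h4, h5⟩ | ⟨i, i', h1, h2, h3, h4, h5⟩ |
      ⟨i, i', π, h1, h2, h3, h4, h5, h6⟩ | ⟨i, i', π, h1, h2, h3, h4, h5, h6⟩)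
    · exact ⟨.inl ⟨i, h1, h3, (A.rel_mem _ _ h5).1⟩, .inl ⟨i', h2, h4, (A.rel_mem _ _ h5).2⟩⟩
    · exact ⟨.inr ⟨i, h1, h3, (R.rel_mem _ _ h5).1⟩, .inr ⟨i', h2, h4, (R.rel_mem _ _ h5).2⟩⟩
    · exact ⟨.inl ⟨i, h1, h3, (A.rel_mem _ _ h5).1⟩, .inr ⟨i', h2, h4, (R.rel_mem _ _ h6).2⟩⟩
    · exact ⟨.inr ⟨i, h1, h3, (R.rel_mem _ _ h5).1⟩, .inl ⟨i', h2, h4, (A.rel_mem _ _ h6).2⟩⟩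
  typ_bot := by
    intro p hp
    split_ifs with h1 h2
    · exact A.typ_bot _ fun h => hp (.inl ⟨p.1, by omega, by simp [outerIdx, h1], h⟩)
    · exact R.typ_bot _ fun h => hp (.inr ⟨p.1 - j, by omega, by simp only [bodyIdx]; omega, h⟩)
    · refine A.typ_bot _ fun h => hp (.inl ⟨p.1 + 2 - R.len, by omega, ?_, h⟩)
      simp only [outerIdx]
      split_ifs <;> omega

theorem AMRS.replacePre_prefixClosed (A : AMRS Feat Ty) (j : ℕ) (R : AMRS Feat Ty)
    (hj : j < A.len) (hR : 0 < R.len) : PrefixClosed (A.replacePre j R hj hR).paths := by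
  rintro k π α (⟨i, h, e, h'⟩ | ⟨i, h, e, h'⟩)
  · exact .inl ⟨i, h, e, A.prefixClosed _ _ _ h'⟩
  · exact .inr ⟨i, h, e, R.prefixClosed _ _ _ h'⟩

theorem AMRS.replacePre_finiteCover (A : AMRS Feat Ty) (j : ℕ) (R : AMRS Feat Ty)
    (hj : j < A.len) (hR : 0 < R.len) : (A.replacePre j R hj hR).FiniteCover := by
  refine PreAMRS.finiteCover_of_map _
    (fun p => (p.1, {q | A.rel (if p.1 < j then p.1 else p.1 + 2 - R.len, p.2) q},
      {q | R.rel (p.1 - j, p.2) q}))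
    (((Set.finite_Iio (A.len + R.len - 2)).prod
      (A.finite_range_class.prod R.finite_range_class)).subset ?_) ?_
  · rintro _ ⟨p, hp, rfl⟩
    exact ⟨(A.replacePre j R hj hR).idx_lt p hp, ⟨_, rfl⟩, ⟨_, rfl⟩⟩
  · intro p hp q hq e
    simp only [Prod.mk.injEq] at e
    obtain ⟨e1, e2, e3⟩ := e
    rcases hq with ⟨i, h, e, h'⟩ | ⟨i, h, e, h'⟩
    · have hi : (if q.1 < j then q.1 else q.1 + 2 - R.len) = i := by
        rw [e, outerIdx]
        split_ifs <;> omega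
      rw [e1, hi] at e2
      exact .inl ⟨i, i, h, h, e1.trans e, e, A.rel_of_class_eq h' e2⟩
    · have hi : q.1 - j = i := by rw [e, bodyIdx]; omega
      rw [e1, hi] at e3
      exact .inr (.inl ⟨i, i, h, h, e1.trans e, e, R.rel_of_class_eq h' e3⟩)

/-- The replacement of element `j` of `A` by the body of `R`. -/
noncomputable def AMRS.replace (A : AMRS Feat Ty) (j : ℕ) (R : AMRS Feat Ty) (hj : j < A.len)
    (hR : 0 < R.len) : AMRS Feat Ty :=
  (A.replacePre j R hj hR).close (A.replacePre_prefixClosed j R hj hR)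
    (A.replacePre_finiteCover j R hj hR)

end Operations

section Grammars

variable {Node Feat Ty Word : Type*} [CompleteLattice Ty]

/-- A grammar: a finite set of rules, which are multi-rooted structures of positive length whose
last element is the head and whose other elements are the body, and a start symbol. -/
structure Grammar (Node Feat : Type*) where
  rules : Set (MRS Node Feat)
  finite_rules : rules.Finite
  rules_pos : ∀ ρ ∈ rules, 0 < ρ.roots.length
  start : TFS Node Feat

/-- `PT_w(j, k)`, with positions of the word counted from `1`: the concatenations of the
abstractions of one category for each of the words at positions `j, …, k`. It is `{λ}` if
`j > k`. -/
def preTerminals (θ : Node → Ty) (Cat : Word → Set (TFS Node Feat)) (w : List Word)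
    (j k : ℕ) : Set (AMRS Feat Ty) :=
  {B | ∃ L : List (TFS Node Feat),
    List.Forall₂ (fun x A => A ∈ Cat x) ((w.drop (j - 1)).take (k + 1 - j)) L ∧
    B = (L.map (TFS.abs θ)).foldr AMRS.concat AMRS.empty}

/-- Strong derivation: element `j` of `A` unifies with the head of some `R` that specializes a
rule, a block of `B` (starting at `i`) unifies with the body of `R`, none of these unifications
adds information, and `B` is `A` with element `j` replaced by the body of `R`. -/
def StrongDer (θ : Node → Ty) (G : Grammar Node Feat) (A B : AMRS Feat Ty) : Prop :=
  ∃ ρ ∈ G.rules, ∃ R : AMRS Feat Ty, ρ.abs θ ≤ R ∧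
    ∃ (j : ℕ) (hj : j < A.len) (hR : 0 < R.len) (i : ℕ), i + (R.len - 1) ≤ B.len ∧
      A.Unif {j} (fun _ => 0) (R.slice (R.len - 1) 1) A ∧
      R.Unif {R.len - 1} (fun _ => 0) (A.slice j 1) R ∧
      B.Unif (Set.Ico i (i + (R.len - 1))) (fun k => k - i) (R.slice 0 (R.len - 1)) B ∧
      R.Unif (Set.Iio (R.len - 1)) id (B.slice i (R.len - 1)) R ∧
      B = A.replace j R hj hR

/-- Derivation `A ⇝ B`: some `A'` unifiable with `A` strongly derives, in any number of steps,
a specialization of `B`. -/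
def Derives (θ : Node → Ty) (G : Grammar Node Feat) (A B : AMRS Feat Ty) : Prop :=
  ∃ A' B' : AMRS Feat Ty, A'.len = A.len ∧ (∃ C, A.Unif (Set.Iio A.len) id A' C) ∧
    B ≤ B' ∧ Relation.ReflTransGen (StrongDer θ G) A' B'

/-- The language `L(G)`. -/
def language (θ : Node → Ty) (Cat : Word → Set (TFS Node Feat)) (G : Grammar Node Feat) :
    Set (List Word) :=
  {w | ∃ B ∈ preTerminals θ Cat w 1 w.length, Derives θ G (G.start.abs θ) B}

/-- The status of an item: active or complete. -/
inductive Status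
  | act
  | comp

/-- Items `[i, A, j, c]`. -/
structure Item (Feat Ty : Type*) [CompleteLattice Ty] where
  i : ℕ
  A : AMRS Feat Ty
  j : ℕ
  c : Status
  le : i ≤ j

/-- Moving the dot over the complete item `β` in the active item `α`. -/
def DotMove (θ : Node → Ty) (G : Grammar Node Feat) (I : Set (Item Feat Ty))
    (x : Item Feat Ty) : Prop :=
  ∃ ρ ∈ G.rules, 1 < (ρ.abs θ).len ∧ ∃ k < (ρ.abs θ).len - 1,
    ∃ α ∈ I, α.c = .act ∧ α.A.len = k ∧ ∃ β ∈ I, β.c = .comp ∧ β.A.len = 1 ∧ α.j = β.i ∧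
    ∃ B C : AMRS Feat Ty, (ρ.abs θ).Unif (Set.Iio k) id α.A B ∧
      B.Unif {k} (fun _ => 0) β.A C ∧
      x.i = α.i ∧ x.A = C.slice 0 (k + 1) ∧ x.j = β.j ∧ x.c = .act

/-- Completion of a rule all of whose body has been recognized by `α`. -/
def Complete (θ : Node → Ty) (G : Grammar Node Feat) (I : Set (Item Feat Ty))
    (x : Item Feat Ty) : Prop :=
  ∃ ρ ∈ G.rules, 1 < (ρ.abs θ).len ∧
    ∃ α ∈ I, α.c = .act ∧ α.A.len = (ρ.abs θ).len - 1 ∧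
    ∃ C : AMRS Feat Ty, (ρ.abs θ).Unif (Set.Iio ((ρ.abs θ).len - 1)) id α.A C ∧
      x.i = α.i ∧ x.A = C.slice ((ρ.abs θ).len - 1) 1 ∧ x.j = α.j ∧ x.c = .comp

/-- The parsing step operator `T_{G,w}`: dot movement, completion, prediction, rules with empty
bodies, and scanning. -/
def parseStep (θ : Node → Ty) (Cat : Word → Set (TFS Node Feat)) (G : Grammar Node Feat)
    (w : List Word) (I : Set (Item Feat Ty)) : Set (Item Feat Ty) :=
  {x | DotMove θ G I x ∨ Complete θ G I x ∨
    (∃ i ≤ w.length, x = ⟨i, AMRS.empty, i, .act, le_rfl⟩) ∨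
    (∃ ρ ∈ G.rules, (ρ.abs θ).len = 1 ∧ ∃ i ≤ w.length, x = ⟨i, ρ.abs θ, i, .comp, le_rfl⟩) ∨
    (∃ (i : ℕ) (hi : i < w.length), ∃ A ∈ Cat w[i],
      x = ⟨i, A.abs θ, i + 1, .comp, Nat.le_succ i⟩)}

/-- The `w`-computation: `I₀ = ∅` and `I_{m+1} = T_{G,w}(I_m)`. -/
def computation (θ : Node → Ty) (Cat : Word → Set (TFS Node Feat)) (G : Grammar Node Feat)
    (w : List Word) : ℕ → Set (Item Feat Ty)
  | 0 => ∅
  | m + 1 => parseStep θ Cat G w (computation θ Cat G w m)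

/-- The computation triggered by `w` is successful: it generates a complete item of length one
that spans all of `w` and is unifiable with the start symbol. -/
def Successful (θ : Node → Ty) (Cat : Word → Set (TFS Node Feat)) (G : Grammar Node Feat)
    (w : List Word) : Prop :=
  ∃ m, ∃ x ∈ computation θ Cat G w m, x.i = 0 ∧ x.j = w.length ∧ x.c = .comp ∧ x.A.len = 1 ∧
    ∃ C, x.A.Unif {0} (fun _ => 0) (G.start.abs θ) C

end Grammars

/-! The parser works bottom-up and strong derivation top-down, so the invariant `Item.Sound` reads
an item as a promise about derivations. Take a consistent structure with a block of elements, each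
at least as specific as the corresponding element of the item. Then the block can be rewritten by
strong derivations into a block lying above pre-terminals of the spanned words, and the elements
around it lose no information. Only elementwise subsumption `ElemLE` is required, so sharing between
elements of an item never has to be tracked.

The main step is the completion of a rule. The item keeps only the head of `C`, a consistent
specialization of the rule, while the element `j` of `A` to be rewritten may be more specific than
that head. Strong derivation demands an exact match, so `specialize` pushes all of element `j` into
`C`, along the reentrancies that connect the head with the body. In the result `R` the head and
element `j` carry the same information, and `R` is consistent because each of its types is bounded
by a type of `C` or of `A` at an existing path. Replacing `j` by the body of `R` then needs no
closure at all (`replace_toPreAMRS`): nothing propagates to the other elements and no type becomes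
`⊤`. `exists_strongDer` packages this step.

Induction on the computation (`computation_sound`) gives the invariant for all items. It is applied
to the unification of the goal item with the start symbol: this structure is above both, so it can
play the role of `A'` in `Derives`, and what it derives is above a concatenation of pre-terminals.
-/

section Soundness

variable {Node Feat Ty Word : Type*} [CompleteLattice Ty]

/-! ### Equality of structures, extension of paths, and structures fixed by the closure. -/

theorem AMRS.ext_toPreAMRS {A B : AMRS Feat Ty} (h : A.toPreAMRS = B.toPreAMRS) : A = B := by
  cases A; cases B; cases h; rfl

theorem PreAMRS.ext_fields {C D : PreAMRS Feat Ty} (h1 : C.len = D.len)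
    (h2 : ∀ p, p ∈ C.paths ↔ p ∈ D.paths) (h3 : ∀ p, C.typ p = D.typ p)
    (h4 : ∀ p q, C.rel p q ↔ D.rel p q) : C = D := by
  replace h2 := Set.ext h2
  replace h3 := funext h3
  replace h4 : C.rel = D.rel := by ext p q; exact h4 p q
  cases C; cases D
  simp only at h1 h2 h3 h4
  subst h1 h2 h3 h4
  rfl

theorem AMRS.root_mem (A : AMRS Feat Ty) {i : ℕ} (hi : i < A.len) : (i, []) ∈ A.paths := by
  obtain ⟨π, h⟩ := A.idx_mem i hi
  exact A.prefixClosed i [] π h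

theorem AMRS.rel_append (A : AMRS Feat Ty) {i i' : ℕ} {π π' : List Feat}
    (h : A.rel (i, π) (i', π')) (α : List Feat) (hα : (i, π ++ α) ∈ A.paths) :
    A.rel (i, π ++ α) (i', π' ++ α) := by
  have hm := (A.rel_mem _ _ h).2
  exact A.symm _ _ (A.fusionClosed i π α i' π' [] hα (by simpa using hm) h).2.2.2

/-- For a symmetric relation, fusion closure amounts to invariance under extension of paths. -/
theorem fusionClosed_of_append {P : Set (IPath Feat)} {r : IPath Feat → IPath Feat → Prop}
    (hm : ∀ p q, r p q → p ∈ P ∧ q ∈ P) (hs : ∀ p q, r p q → r q p)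
    (h : ∀ i π i' π' α, r (i, π) (i', π') → (i, π ++ α) ∈ P → r (i, π ++ α) (i', π' ++ α)) :
    FusionClosed P r := by
  intro i π α i' π' α' h1 h2 h3
  have a := h i π i' π' α h3 h1
  have b := h i' π' i π α' (hs _ _ h3) h2
  exact ⟨(hm _ _ b).2, (hm _ _ a).2, hs _ _ b, hs _ _ a⟩

/-- The closure operations do not change a structure that has all the closure properties. -/
theorem PreAMRS.cl_eqv_ty_eq_self (C : PreAMRS Feat Ty) (hp : PrefixClosed C.paths)
    (hf : FusionClosed C.paths C.rel) (hr : ∀ p ∈ C.paths, C.rel p p)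
    (hs : ∀ p q, C.rel p q → C.rel q p) (ht : ∀ p q s, C.rel p q → C.rel q s → C.rel p s)
    (hty : ∀ p q, C.rel p q → C.typ p = C.typ q) : C.cl.eqv.ty = C := by
  have hce : C.ClosedExt C.paths C.rel := ⟨subset_rfl, fun _ _ h => h, C.rel_mem, hp, hf⟩
  have e1 : C.cl.paths = C.paths :=
    Set.Subset.antisymm (fun p h => h _ _ hce) C.cl_closedExt.paths_sub
  have e2 : C.cl.rel = C.rel := by
    ext p q
    exact ⟨fun h => h _ _ hce, C.cl_closedExt.rel_sub p q⟩
  have e3 : C.cl.eqv.rel = C.rel := by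
    ext p q
    show (p ∈ C.cl.paths ∧ q ∈ C.cl.paths ∧ Relation.EqvGen C.cl.rel p q) ↔ _
    rw [e1, e2]
    refine ⟨fun ⟨h1, h2, h3⟩ => ?_, fun h => ⟨(C.rel_mem _ _ h).1, (C.rel_mem _ _ h).2, .rel _ _ h⟩⟩
    -- `EqvGen` is reflexive on all indexed paths, also outside `C.paths`, hence the separate case
    -- `p = q`.
    have : ∀ p q, Relation.EqvGen C.rel p q → p = q ∨ C.rel p q := by
      intro p q h
      induction h with
      | rel p q h => exact .inr h
      | refl p => exact .inl rfl
      | symm p q _ ih => exact ih.imp Eq.symm (hs _ _)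
      | trans p q s _ _ ih1 ih2 =>
        rcases ih1 with rfl | ih1
        · exact ih2
        · rcases ih2 with rfl | ih2
          · exact .inr ih1
          · exact .inr (ht _ _ _ ih1 ih2)
    rcases this p q h3 with rfl | h
    · exact hr p h1
    · exact h
  have e4 : C.cl.eqv.ty.typ = C.typ := by
    ext p
    show (⨆ q ∈ {q | C.cl.eqv.rel p q}, C.typ q) = C.typ p
    rw [e3]
    refine le_antisymm (iSup₂_le fun q h => (hty p q h).ge) ?_
    by_cases h : p ∈ C.paths
    · exact le_iSup₂_of_le p (hr p h) le_rfl
    · rw [C.typ_bot p h]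
      exact bot_le
  exact PreAMRS.ext_fields rfl (fun p => iff_of_eq (congrArg (p ∈ ·) e1)) (congrFun e4)
    fun p q => iff_of_eq (congrFun (congrFun e3 p) q)

theorem AMRS.toPreAMRS_cl_eqv_ty (A : AMRS Feat Ty) : A.toPreAMRS.cl.eqv.ty = A.toPreAMRS :=
  A.toPreAMRS.cl_eqv_ty_eq_self A.prefixClosed A.fusionClosed A.refl A.symm A.trans A.typ_rel

/-! ### Bounds for unification -/

/-- Unification with a structure that is subsumed by the matched elements adds nothing. -/
theorem AMRS.unify_eq_self {A B : AMRS Feat Ty} {J : Set ℕ} {f : ℕ → ℕ}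
    (hp : ∀ i < A.len, i ∈ J → ∀ π, (f i, π) ∈ B.paths → (i, π) ∈ A.paths)
    (hr : ∀ i < A.len, i ∈ J → ∀ i' < A.len, i' ∈ J → ∀ π π',
      B.rel (f i, π) (f i', π') → A.rel (i, π) (i', π'))
    (ht : ∀ i < A.len, i ∈ J → ∀ π, B.typ (f i, π) ≤ A.typ (i, π)) : A.unify J f B = A := by
  have e : A.unifyPre J f B = A.toPreAMRS := by
    refine PreAMRS.ext_fields rfl (fun p => ?_) (fun p => ?_) fun p q => ?_
    · exact ⟨fun h => h.elim id fun h => hp p.1 h.1.1 h.1.2 p.2 h.2, .inl⟩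
    · unfold AMRS.unifyPre
      dsimp only
      split_ifs with h
      · exact sup_eq_left.2 (ht p.1 h.1 h.2 p.2)
      · rfl
    · exact ⟨fun h => h.elim id fun h => hr _ h.1.1 h.1.2 _ h.2.1.1 h.2.1.2 _ _ h.2.2, .inl⟩
  apply AMRS.ext_toPreAMRS
  show (A.unifyPre J f B).cl.eqv.ty = _
  rw [e, A.toPreAMRS_cl_eqv_ty]

/-- When `A ≤ B` the union of the two is already `B`, which is closed. This provides the
unifiability with the start symbol that `Derives` asks for. -/
theorem AMRS.unify_iio_eq_right {A B : AMRS Feat Ty} (h : A ≤ B) :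
    A.unify (Set.Iio A.len) id B = B := by
  obtain ⟨h1, h2, h3, h4⟩ := h
  have e : A.unifyPre (Set.Iio A.len) id B = B.toPreAMRS := by
    refine PreAMRS.ext_fields h1 (fun p => ?_) (fun p => ?_) fun p q => ?_
    · exact ⟨fun h => h.elim (fun h => h2 h) And.right, fun h =>
        have := h1 ▸ B.idx_lt p h; .inr ⟨⟨this, this⟩, h⟩⟩
    · unfold AMRS.unifyPre
      dsimp only
      have hle : A.typ p ≤ B.typ p := by
        by_cases hp : p ∈ A.paths
        · exact h4 p hp
        · rw [A.typ_bot p hp]; exact bot_le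
      split_ifs with h
      · exact sup_eq_right.2 hle
      · have hp : p ∉ B.paths := fun hp => by
          have := h1 ▸ B.idx_lt p hp
          exact h ⟨this, this⟩
        rw [B.typ_bot p hp] at hle ⊢
        exact le_bot_iff.1 hle
    · refine ⟨fun h => h.elim (h3 _ _) fun h => h.2.2, fun h => ?_⟩
      have a := h1 ▸ B.idx_lt _ (B.rel_mem _ _ h).1
      have b := h1 ▸ B.idx_lt _ (B.rel_mem _ _ h).2
      exact .inr ⟨⟨a, a⟩, ⟨b, b⟩, h⟩
  apply AMRS.ext_toPreAMRS
  show (A.unifyPre (Set.Iio A.len) id B).cl.eqv.ty = _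
  rw [e, B.toPreAMRS_cl_eqv_ty]

theorem PreAMRS.close_bounds (C : PreAMRS Feat Ty) (hp : PrefixClosed C.paths)
    (hf : C.FiniteCover) : C.paths ⊆ (C.close hp hf).paths ∧
      (∀ p q, C.rel p q → (C.close hp hf).rel p q) ∧
      ∀ p ∈ C.paths, C.typ p ≤ (C.close hp hf).typ p := by
  have h := C.cl_closedExt
  refine ⟨h.paths_sub, fun p q hpq => ⟨h.paths_sub (C.rel_mem _ _ hpq).1,
    h.paths_sub (C.rel_mem _ _ hpq).2, .rel _ _ (h.rel_sub _ _ hpq)⟩, fun p hpp => ?_⟩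
  exact le_iSup₂_of_le (f := fun q (_ : q ∈ {q | C.cl.eqv.rel p q}) => C.typ q) p
    ⟨h.paths_sub hpp, h.paths_sub hpp, .refl _⟩ le_rfl

/-- Element `t` of `a` subsumes element `j` of `A`. -/
structure AMRS.ElemLE (a : AMRS Feat Ty) (t : ℕ) (A : AMRS Feat Ty) (j : ℕ) : Prop where
  paths : ∀ π, (t, π) ∈ a.paths → (j, π) ∈ A.paths
  rel : ∀ π π', a.rel (t, π) (t, π') → A.rel (j, π) (j, π')
  typ : ∀ π, a.typ (t, π) ≤ A.typ (j, π)

theorem AMRS.ElemLE.trans {a b c : AMRS Feat Ty} {i j k : ℕ} (h : a.ElemLE i b j)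
    (h' : b.ElemLE j c k) : a.ElemLE i c k :=
  ⟨fun π hπ => h'.paths π (h.paths π hπ), fun _ _ hr => h'.rel _ _ (h.rel _ _ hr),
    fun π => (h.typ π).trans (h'.typ π)⟩

theorem AMRS.ElemLE.refl (a : AMRS Feat Ty) (i : ℕ) : a.ElemLE i a i :=
  ⟨fun _ h => h, fun _ _ h => h, fun _ => le_rfl⟩

theorem AMRS.elemLE_of_le {A B : AMRS Feat Ty} (h : A ≤ B) (i : ℕ) : A.ElemLE i B i := by
  refine ⟨fun _ hπ => h.2.1 hπ, fun _ _ => h.2.2.1 _ _, fun π => ?_⟩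
  by_cases hp : (i, π) ∈ A.paths
  · exact h.2.2.2 _ hp
  · rw [A.typ_bot _ hp]; exact bot_le

/-- No bound on `t` is needed: from `l` on, the slice has no paths and its types are `⊥`. -/
theorem AMRS.elemLE_slice_left (C : AMRS Feat Ty) (m l t : ℕ) :
    (C.slice m l).ElemLE t C (m + t) := by
  refine ⟨fun _ h => h.2, fun _ _ h => h.2.2, fun π => ?_⟩
  show ite _ _ _ ≤ _
  split_ifs
  · exact le_rfl
  · exact bot_le

theorem AMRS.elemLE_slice_right (C : AMRS Feat Ty) (m : ℕ) {l t : ℕ} (ht : t < l) :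
    C.ElemLE (m + t) (C.slice m l) t :=
  ⟨fun _ h => ⟨ht, h⟩, fun _ _ h => ⟨ht, ht, h⟩,
    fun _ => (if_pos (α := Ty) (c := t < l) ht).ge⟩

/-- Apart from lengths and consistency, the unifications made by the parser enter the argument only
as upper bounds: of the first structure here, and of the matched elements of the second in
`elemLE_unify`. -/
theorem AMRS.le_unify (A : AMRS Feat Ty) (J : Set ℕ) (f : ℕ → ℕ) (B : AMRS Feat Ty) :
    A ≤ A.unify J f B := by
  obtain ⟨h1, h2, h3⟩ := (A.unifyPre J f B).close_bounds (A.unifyPre_prefixClosed J f B)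
    (A.unifyPre_finiteCover J f B)
  refine ⟨rfl, fun p hp => h1 (.inl hp), fun p q h => h2 p q (.inl h), fun p hp =>
    le_trans ?_ (h3 p (.inl hp))⟩
  unfold AMRS.unifyPre
  dsimp only
  split_ifs
  · exact le_sup_left
  · exact le_rfl

theorem AMRS.elemLE_unify (A : AMRS Feat Ty) {J : Set ℕ} (f : ℕ → ℕ) (B : AMRS Feat Ty) {i : ℕ}
    (hi : i < A.len) (hJ : i ∈ J) : B.ElemLE (f i) (A.unify J f B) i := by
  obtain ⟨h1, h2, h3⟩ := (A.unifyPre J f B).close_bounds (A.unifyPre_prefixClosed J f B)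
    (A.unifyPre_finiteCover J f B)
  refine ⟨fun _ h => h1 (.inr ⟨⟨hi, hJ⟩, h⟩),
    fun _ _ h => h2 _ _ (.inr ⟨⟨hi, hJ⟩, ⟨hi, hJ⟩, h⟩), fun π => ?_⟩
  by_cases hp : (f i, π) ∈ B.paths
  · refine le_trans ?_ (h3 (i, π) (.inr ⟨⟨hi, hJ⟩, hp⟩))
    unfold AMRS.unifyPre
    dsimp only
    rw [if_pos ⟨hi, hJ⟩]
    exact le_sup_right
  · rw [B.typ_bot _ hp]; exact bot_le

/-! ### Specializing the head of a rule -/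

/-- The path `p` of `C` leads to the path `π` of element `h`. -/
def AMRS.Link (C : AMRS Feat Ty) (h : ℕ) (p : IPath Feat) (π : List Feat) : Prop :=
  ∃ π₁ α π₃, p.2 = π₁ ++ α ∧ C.rel (p.1, π₁) (h, π₃) ∧ π = π₃ ++ α

theorem AMRS.Link.append {C : AMRS Feat Ty} {h i : ℕ} {ρ π : List Feat}
    (hl : C.Link h (i, ρ) π) (β : List Feat) : C.Link h (i, ρ ++ β) (π ++ β) := by
  obtain ⟨π₁, α, π₃, e, hr, rfl⟩ := hl
  simp only at e
  exact ⟨π₁, α ++ β, π₃, by simp [e], hr, by simp⟩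

theorem AMRS.Link.rel_of_mem {C : AMRS Feat Ty} {h : ℕ} {p : IPath Feat} {π : List Feat}
    (hl : C.Link h p π) (hp : p ∈ C.paths) : C.rel p (h, π) := by
  obtain ⟨i, ρ⟩ := p
  obtain ⟨π₁, α, π₃, e, hr, rfl⟩ := hl
  simp only at e hr
  subst e
  exact C.rel_append hr α hp

theorem AMRS.link_of_rel {C : AMRS Feat Ty} {h : ℕ} {p : IPath Feat} {π : List Feat}
    (hr : C.rel p (h, π)) : C.Link h p π :=
  ⟨p.2, [], π, by simp, hr, by simp⟩

/-- Since `q` is a path of `C`, its link is a genuine equivalence of `C` and can be composed with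
`hr`. -/
theorem AMRS.Link.of_rel {C : AMRS Feat Ty} {h : ℕ} {p q : IPath Feat} {π : List Feat}
    (hl : C.Link h q π) (hr : C.rel p q) : C.Link h p π :=
  AMRS.link_of_rel (C.trans _ _ _ hr (hl.rel_of_mem (C.rel_mem _ _ hr).2))

theorem AMRS.link_self {C : AMRS Feat Ty} {h : ℕ} (hh : h < C.len) (π : List Feat) :
    C.Link h (h, π) π :=
  ⟨[], π, [], rfl, C.refl _ (C.root_mem hh), rfl⟩

/-- A path may enter element `h` at several of its prefixes. Of two such prefixes one extends the
other, so fusion in `C` identifies the two images at the longer prefix; `hle` carries this over to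
`A`, and fusion in `A` carries it to the full path. Linking is thus single-valued modulo the
equivalence of `A`, which all of the specialization rests on. -/
theorem AMRS.Link.rel_unique {C A : AMRS Feat Ty} {h j : ℕ} (hle : C.ElemLE h A j)
    {p : IPath Feat} {π π' : List Feat} (hl : C.Link h p π) (hl' : C.Link h p π')
    (hm : (j, π) ∈ A.paths) : A.rel (j, π) (j, π') := by
  obtain ⟨i, ρ⟩ := p
  have aux : ∀ {π₁ γ π₃ π₄}, C.rel (i, π₁) (h, π₃) → C.rel (i, π₁ ++ γ) (h, π₄) →
      A.rel (j, π₃ ++ γ) (j, π₄) := by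
    intro π₁ γ π₃ π₄ h1 h2
    have h3 := C.rel_append h1 γ (C.rel_mem _ _ h2).1
    exact hle.rel _ _ (C.trans _ _ _ (C.symm _ _ h3) h2)
  obtain ⟨π₁, α, π₃, e, hr, rfl⟩ := hl
  obtain ⟨π₁', α', π₃', e', hr', rfl⟩ := hl'
  simp only at e e' hr hr'
  rcases List.append_eq_append_iff.1 (e.symm.trans e') with ⟨γ, rfl, rfl⟩ | ⟨γ, rfl, rfl⟩
  · have := A.rel_append (aux hr hr') α' (by simpa using hm)
    simpa using this
  · have := A.rel_append (A.symm _ _ (aux hr' hr)) α hm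
    simpa using this

/-- The reentrancies of `C` with its element `h` specialized to element `j` of `A`. -/
def AMRS.SpecRel (C : AMRS Feat Ty) (h : ℕ) (A : AMRS Feat Ty) (j : ℕ) (p q : IPath Feat) : Prop :=
  C.rel p q ∨ ∃ π π', C.Link h p π ∧ C.Link h q π' ∧ A.rel (j, π) (j, π')

theorem AMRS.SpecRel.symm {C A : AMRS Feat Ty} {h j : ℕ} {p q : IPath Feat} :
    C.SpecRel h A j p q → C.SpecRel h A j q p := by
  rintro (hr | ⟨π, π', h1, h2, h3⟩)
  · exact .inl (C.symm _ _ hr)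
  · exact .inr ⟨π', π, h2, h1, A.symm _ _ h3⟩

/-- A link is moved along an equivalence of `C`; when both steps pass through `A`, the two images of
the middle path `q` are equivalent by `rel_unique`. -/
theorem AMRS.SpecRel.trans {C A : AMRS Feat Ty} {h j : ℕ} (hle : C.ElemLE h A j)
    {p q s : IPath Feat} :
    C.SpecRel h A j p q → C.SpecRel h A j q s → C.SpecRel h A j p s := by
  rintro (hr | ⟨π, π', h1, h2, h3⟩) (hr' | ⟨ρ, ρ', h1', h2', h3'⟩)
  · exact .inl (C.trans _ _ _ hr hr')
  · exact .inr ⟨ρ, ρ', h1'.of_rel hr, h2', h3'⟩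
  · exact .inr ⟨π, π', h1, h2.of_rel (C.symm _ _ hr'), h3⟩
  · exact .inr ⟨π, ρ', h1, h2', A.trans _ _ _ (A.trans _ _ _ h3
      (h2.rel_unique hle h1' (A.rel_mem _ _ h3).2)) h3'⟩

theorem AMRS.SpecRel.mem {C A : AMRS Feat Ty} {h j : ℕ} {p q : IPath Feat} :
    C.SpecRel h A j p q → (p ∈ C.paths ∨ ∃ π, C.Link h p π ∧ (j, π) ∈ A.paths) ∧
      (q ∈ C.paths ∨ ∃ π, C.Link h q π ∧ (j, π) ∈ A.paths) := by
  rintro (hr | ⟨π, π', h1, h2, h3⟩)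
  · exact ⟨.inl (C.rel_mem _ _ hr).1, .inl (C.rel_mem _ _ hr).2⟩
  · exact ⟨.inr ⟨π, h1, (A.rel_mem _ _ h3).1⟩, .inr ⟨π', h2, (A.rel_mem _ _ h3).2⟩⟩

/-- `C` with its element `h` specialized to element `j` of `A`. -/
noncomputable def AMRS.specialize (C : AMRS Feat Ty) (h : ℕ) (A : AMRS Feat Ty) (j : ℕ)
    (hle : C.ElemLE h A j) : AMRS Feat Ty where
  len := C.len
  paths := {p | p ∈ C.paths ∨ ∃ π, C.Link h p π ∧ (j, π) ∈ A.paths}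
  -- By `rel_unique` all links of `p` yield the same type; the join avoids choosing one, and gives
  -- `⊥` if there is none.
  typ := fun p => C.typ p ⊔ ⨆ π ∈ {π | C.Link h p π}, A.typ (j, π)
  rel := C.SpecRel h A j
  idx_lt := by
    rintro p (hp | ⟨π, ⟨π₁, α, π₃, -, hr, -⟩, -⟩)
    · exact C.idx_lt p hp
    · have := C.idx_lt _ (C.rel_mem _ _ hr).1
      exact this
  idx_mem := fun i hi => ⟨[], .inl (C.root_mem hi)⟩
  rel_mem := fun _ _ h => h.mem
  typ_bot := by
    intro p hp
    rw [C.typ_bot p fun h => hp (.inl h), bot_sup_eq]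
    simp only [iSup_eq_bot]
    exact fun π hπ => A.typ_bot _ fun h => hp (.inr ⟨π, hπ, h⟩)
  prefixClosed := by
    rintro i π α (hp | ⟨π', ⟨π₁, β, π₃, e, hr, rfl⟩, hm⟩)
    · exact .inl (C.prefixClosed _ _ _ hp)
    · simp only at e hr
      rcases List.append_eq_append_iff.1 e with ⟨γ, rfl, rfl⟩ | ⟨γ, rfl, rfl⟩
      · exact .inl (C.prefixClosed _ _ _ (C.rel_mem _ _ hr).1)
      · exact .inr ⟨π₃ ++ γ, ⟨π₁, γ, π₃, rfl, hr, rfl⟩,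
          A.prefixClosed _ _ α (by simpa using hm)⟩
  fusionClosed := by
    refine fusionClosed_of_append (fun _ _ h => h.mem) (fun _ _ h => h.symm) ?_
    · rintro i ρ i' ρ' α (hr | ⟨π, π', h1, h2, h3⟩) hm
      · rcases hm with hm | ⟨π, hl, hm⟩
        · exact .inl (C.rel_append hr α hm)
        · refine .inr ⟨π, π, hl, ?_, A.refl _ hm⟩
          obtain ⟨π₁, β, π₃, e, hl, rfl⟩ := hl
          simp only at e hl
          -- The entry into element `h` lies either at or beyond the end of `ρ`, inside `α`, or
          -- within `ρ` itself.
          rcases List.append_eq_append_iff.1 e with ⟨γ, rfl, rfl⟩ | ⟨γ, rfl, rfl⟩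
          · have := C.rel_append hr γ (C.rel_mem _ _ hl).1
            exact ⟨ρ' ++ γ, β, π₃, by simp, C.trans _ _ _ (C.symm _ _ this) hl, rfl⟩
          · have : C.Link h (i, π₁ ++ γ) (π₃ ++ γ) := ⟨π₁, γ, π₃, rfl, hl, rfl⟩
            simpa using (this.of_rel (C.symm _ _ hr)).append α
      · have h1' := h1.append α
        refine .inr ⟨π ++ α, π' ++ α, h1', h2.append α, A.rel_append h3 α ?_⟩
        rcases hm with hm | ⟨π'', hl, hm⟩
        · exact hle.paths _ (C.rel_mem _ _ (h1'.rel_of_mem hm)).2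
        · exact (A.rel_mem _ _ (hl.rel_unique hle h1' hm)).2
  refl := by
    rintro p (hp | ⟨π, hl, hm⟩)
    · exact .inl (C.refl p hp)
    · exact .inr ⟨π, π, hl, hl, A.refl _ hm⟩
  symm := fun _ _ h => h.symm
  trans := fun _ _ _ h h' => h.trans hle h'
  finite_index := by
    -- A class is determined by the class of `p` in `C` and that of its images in `A`; by
    -- `rel_unique` the second is a single class of `A` or empty.
    refine finite_index_of_map (fun _ _ h => h.symm) (fun _ _ _ h h' => h.trans hle h')
      (fun p => ({q | C.rel p q}, {q | ∃ π, C.Link h p π ∧ A.rel (j, π) q}))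
      ((C.finite_range_class.prod (A.finite_range_class.union (Set.finite_singleton ∅))).subset
        ?_) ?_
    · rintro _ ⟨p, -, rfl⟩
      refine ⟨⟨p, rfl⟩, ?_⟩
      by_cases hl : ∃ π, C.Link h p π ∧ (j, π) ∈ A.paths
      · obtain ⟨π, hl, hm⟩ := hl
        refine .inl ⟨(j, π), Set.ext fun q => ⟨fun hq => ⟨π, hl, hq⟩, ?_⟩⟩
        rintro ⟨π', hl', hq⟩
        exact A.trans _ _ _ (hl.rel_unique hle hl' hm) hq
      · refine .inr (Set.eq_empty_iff_forall_notMem.2 ?_)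
        rintro q ⟨π, hl', hq⟩
        exact hl ⟨π, hl', (A.rel_mem _ _ hq).1⟩
    · rintro p (hp | ⟨π, hl, hm⟩) q - e
      · refine .inl (C.symm _ _ ?_)
        have : p ∈ {s | C.rel p s} := C.refl p hp
        rw [(Prod.mk.inj e).1] at this
        exact this
      · refine .inr ?_
        have : (j, π) ∈ {s | ∃ π, C.Link h p π ∧ A.rel (j, π) s} := ⟨π, hl, A.refl _ hm⟩
        rw [(Prod.mk.inj e).2] at this
        obtain ⟨π', hl', hr⟩ := this
        exact ⟨π, π', hl, hl', A.symm _ _ hr⟩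
  typ_rel := by
    have key : ∀ p q, C.SpecRel h A j p q → C.typ p ⊔ ⨆ π ∈ {π | C.Link h p π}, A.typ (j, π) ≤
        C.typ q ⊔ ⨆ π ∈ {π | C.Link h q π}, A.typ (j, π) := by
      rintro p q (hr | ⟨π, π', h1, h2, h3⟩)
      · refine sup_le_sup (C.typ_rel _ _ hr).le (iSup₂_le fun π hπ => ?_)
        exact le_iSup₂_of_le (f := fun π (_ : π ∈ {π | C.Link h q π}) => A.typ (j, π)) π
          (AMRS.Link.of_rel hπ (C.symm _ _ hr)) le_rfl
      · have hb : A.typ (j, π) ≤ C.typ q ⊔ ⨆ π ∈ {π | C.Link h q π}, A.typ (j, π) := by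
          rw [A.typ_rel _ _ h3]
          exact le_sup_of_le_right (le_iSup₂_of_le
            (f := fun π (_ : π ∈ {π | C.Link h q π}) => A.typ (j, π)) π' h2 le_rfl)
        refine sup_le ?_ (iSup₂_le fun ρ hρ => ?_)
        · by_cases hp : p ∈ C.paths
          · refine le_trans ?_ hb
            rw [C.typ_rel _ _ (h1.rel_of_mem hp)]
            exact hle.typ π
          · rw [C.typ_bot p hp]; exact bot_le
        · rw [← A.typ_rel _ _ (h1.rel_unique hle hρ (A.rel_mem _ _ h3).1)]
          exact hb
    exact fun p q hr => le_antisymm (key p q hr) (key q p hr.symm)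

theorem AMRS.le_specialize {C A : AMRS Feat Ty} {h j : ℕ} (hle : C.ElemLE h A j) :
    C ≤ C.specialize h A j hle :=
  ⟨rfl, fun _ hp => .inl hp, fun _ _ hr => .inl hr, fun _ _ => le_sup_left⟩

/-- Each path of element `h` links to itself, so any other image is equivalent to it in `A` by
`rel_unique`. With `elemLE_specialize`, the new element `h` and element `j` of `A` carry the same
information. -/
theorem AMRS.specialize_elemLE {C A : AMRS Feat Ty} {h j : ℕ} (hle : C.ElemLE h A j) :
    (C.specialize h A j hle).ElemLE h A j where
  paths := by
    rintro π (hp | ⟨π', hl, hm⟩)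
    · exact hle.paths π hp
    · have hh : h < C.len := by
        obtain ⟨_, _, _, -, hr, -⟩ := hl
        exact C.idx_lt _ (C.rel_mem _ _ hr).2
      exact (A.rel_mem _ _ (hl.rel_unique hle (AMRS.link_self hh π) hm)).2
  rel := by
    rintro π π' (hr | ⟨ρ, ρ', h1, h2, h3⟩)
    · exact hle.rel _ _ hr
    · have hh : h < C.len := by
        obtain ⟨_, _, _, -, hr, -⟩ := h1
        exact C.idx_lt _ (C.rel_mem _ _ hr).2
      have a := h1.rel_unique hle (AMRS.link_self hh π) (A.rel_mem _ _ h3).1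
      have b := h2.rel_unique hle (AMRS.link_self hh π') (A.rel_mem _ _ h3).2
      exact A.trans _ _ _ (A.symm _ _ a) (A.trans _ _ _ h3 b)
  typ := by
    intro π
    refine sup_le (hle.typ π) (iSup₂_le fun π' hl => ?_)
    by_cases hm : (j, π') ∈ A.paths
    · have hh : h < C.len := by
        obtain ⟨_, _, _, -, hr, -⟩ := hl
        exact C.idx_lt _ (C.rel_mem _ _ hr).2
      exact (A.typ_rel _ _ (AMRS.Link.rel_unique hle hl (AMRS.link_self hh π) hm)).le
    · rw [A.typ_bot _ hm]
      exact bot_le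

theorem AMRS.elemLE_specialize {C A : AMRS Feat Ty} {h j : ℕ} (hle : C.ElemLE h A j)
    (hh : h < C.len) : A.ElemLE j (C.specialize h A j hle) h :=
  ⟨fun π hπ => .inr ⟨π, AMRS.link_self hh π, hπ⟩,
    fun π π' hr => .inr ⟨π, π', AMRS.link_self hh π, AMRS.link_self hh π', hr⟩,
    fun π => le_sup_of_le_right (le_iSup₂_of_le
      (f := fun π' (_ : π' ∈ {π' | C.Link h (h, π) π'}) => A.typ (j, π')) π
      (AMRS.link_self hh π) le_rfl)⟩

theorem AMRS.typ_ne_top {A : AMRS Feat Ty} (hA : ¬ A.Fails) {p : IPath Feat}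
    (hp : p ∈ A.paths) : A.typ p ≠ ⊤ :=
  fun h => hA ⟨p, hp, h⟩

/-- A path with an image in `A` has a type below that of its image, because `C` is below `A` there;
any other path keeps its type from `C`. -/
theorem AMRS.specialize_not_fails {C A : AMRS Feat Ty} {h j : ℕ} (hle : C.ElemLE h A j)
    (hC : ¬ C.Fails) (hA : ¬ A.Fails) : ¬ (C.specialize h A j hle).Fails := by
  rintro ⟨p, hp, ht⟩
  change C.typ p ⊔ ⨆ π ∈ {π | C.Link h p π}, A.typ (j, π) = ⊤ at ht
  by_cases hl : ∃ π, C.Link h p π ∧ (j, π) ∈ A.paths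
  · obtain ⟨π, hl, hm⟩ := hl
    refine AMRS.typ_ne_top hA hm (top_le_iff.1 (ht ▸ sup_le ?_ (iSup₂_le fun ρ hρ => ?_)))
    · by_cases hpC : p ∈ C.paths
      · rw [C.typ_rel _ _ (hl.rel_of_mem hpC)]
        exact hle.typ π
      · rw [C.typ_bot p hpC]
        exact bot_le
    · exact (A.typ_rel _ _ (hl.rel_unique hle hρ hm)).ge
  · have hb : ⨆ π ∈ {π | C.Link h p π}, A.typ (j, π) = ⊥ := by
      simp only [iSup_eq_bot]
      exact fun π hπ => A.typ_bot _ fun hm => hl ⟨π, hπ, hm⟩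
    rw [hb, sup_bot_eq] at ht
    exact AMRS.typ_ne_top hC (hp.resolve_right hl) ht

/-! ### Replacement of an element that equals the head of the rule -/

/-- An index that is shifted exceeds `j`, hence is at least `1`; with `0 < n` the subtraction in
`outerIdx` is not truncated. -/
theorem outerIdx_inj {j n i i' : ℕ} (hn : 0 < n) (hi : i ≠ j) (hi' : i' ≠ j)
    (h : outerIdx j n i = outerIdx j n i') : i = i' := by
  simp only [outerIdx] at h
  split_ifs at h <;> omega

theorem outerIdx_ne_bodyIdx {j n i i' : ℕ} (hi : i ≠ j) (hi' : i' < n - 1) :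
    outerIdx j n i ≠ bodyIdx j i' := by
  simp only [outerIdx, bodyIdx]
  split_ifs <;> omega

theorem bodyIdx_inj {j i i' : ℕ} (h : bodyIdx j i = bodyIdx j i') : i = i' :=
  Nat.add_right_cancel h

variable {A R : AMRS Feat Ty} {j : ℕ} {hj : j < A.len} {hR : 0 < R.len}

theorem AMRS.replacePre_typ_outer {i : ℕ} (hi : i ≠ j) (π : List Feat) :
    (A.replacePre j R hj hR).typ (outerIdx j R.len i, π) = A.typ (i, π) := by
  unfold AMRS.replacePre outerIdx
  dsimp only
  split_ifs <;> first | rfl | omega | (congr 2; omega)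

theorem AMRS.replacePre_typ_body {i : ℕ} (hi : i < R.len - 1) (π : List Feat) :
    (A.replacePre j R hj hR).typ (bodyIdx j i, π) = R.typ (i, π) := by
  unfold AMRS.replacePre bodyIdx
  dsimp only
  rw [if_neg (by omega), if_pos (by omega)]
  congr 2
  omega

theorem AMRS.replacePre_mem_outer {i : ℕ} (hi : i ≠ j) {π : List Feat} :
    (outerIdx j R.len i, π) ∈ (A.replacePre j R hj hR).paths ↔ (i, π) ∈ A.paths := by
  constructor
  · rintro (⟨i', h, e, h'⟩ | ⟨i', h, e, h'⟩)
    · rw [outerIdx_inj hR hi h e]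
      exact h'
    · exact absurd e (outerIdx_ne_bodyIdx hi h)
  · exact fun h => .inl ⟨i, hi, rfl, h⟩

theorem AMRS.replacePre_mem_body {i : ℕ} (hi : i < R.len - 1) {π : List Feat} :
    (bodyIdx j i, π) ∈ (A.replacePre j R hj hR).paths ↔ (i, π) ∈ R.paths := by
  constructor
  · rintro (⟨i', h, e, h'⟩ | ⟨i', h, e, h'⟩)
    · exact absurd e.symm (outerIdx_ne_bodyIdx h hi)
    · rw [bodyIdx_inj e]
      exact h'
  · exact fun h => .inr ⟨i, hi, rfl, h⟩

theorem AMRS.replacePre_rel_body {i i' : ℕ} (hi : i < R.len - 1) (hi' : i' < R.len - 1)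
    {π π' : List Feat} :
    (A.replacePre j R hj hR).rel (bodyIdx j i, π) (bodyIdx j i', π') ↔
      R.rel (i, π) (i', π') := by
  constructor
  · rintro (⟨k, k', h1, h2, h3, h4, h5⟩ | ⟨k, k', h1, h2, h3, h4, h5⟩ |
      ⟨k, k', ρ, h1, h2, h3, h4, h5, h6⟩ | ⟨k, k', ρ, h1, h2, h3, h4, h5, h6⟩)
    · exact absurd h3.symm (outerIdx_ne_bodyIdx h1 hi)
    · rw [bodyIdx_inj h3, bodyIdx_inj h4]
      exact h5
    · exact absurd h3.symm (outerIdx_ne_bodyIdx h1 hi)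
    · exact absurd h4.symm (outerIdx_ne_bodyIdx h2 hi')
  · exact fun h => .inr (.inl ⟨i, i', hi, hi', rfl, rfl, h⟩)

theorem AMRS.replacePre_symm {p q : IPath Feat} :
    (A.replacePre j R hj hR).rel p q → (A.replacePre j R hj hR).rel q p := by
  rintro (⟨i, i', h1, h2, h3, h4, h5⟩ | ⟨i, i', h1, h2, h3, h4, h5⟩ |
    ⟨i, i', π, h1, h2, h3, h4, h5, h6⟩ | ⟨i, i', π, h1, h2, h3, h4, h5, h6⟩)
  · exact .inl ⟨i', i, h2, h1, h4, h3, A.symm _ _ h5⟩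
  · exact .inr (.inl ⟨i', i, h2, h1, h4, h3, R.symm _ _ h5⟩)
  · exact .inr (.inr (.inr ⟨i', i, π, h2, h1, h4, h3, R.symm _ _ h6, A.symm _ _ h5⟩))
  · exact .inr (.inr (.inl ⟨i', i, π, h2, h1, h4, h3, A.symm _ _ h6, R.symm _ _ h5⟩))

/-- Disjointness of outer and body indices excludes half of the cases. The essential ones go from
outside through the body and back, or the reverse: they meet two paths of the head that are
equivalent in `R`, or two paths of element `j` equivalent in `A`, and `h2` or `h1` transfers that
equivalence to the other structure. -/
theorem AMRS.replacePre_trans (h1 : A.ElemLE j R (R.len - 1)) (h2 : R.ElemLE (R.len - 1) A j)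
    {p q s : IPath Feat} : (A.replacePre j R hj hR).rel p q → (A.replacePre j R hj hR).rel q s →
      (A.replacePre j R hj hR).rel p s := by
  rintro (⟨i, i', a1, a2, a3, a4, a5⟩ | ⟨i, i', a1, a2, a3, a4, a5⟩ |
      ⟨i, i', π, a1, a2, a3, a4, a5, a6⟩ | ⟨i, i', π, a1, a2, a3, a4, a5, a6⟩)
    (⟨k, k', b1, b2, b3, b4, b5⟩ | ⟨k, k', b1, b2, b3, b4, b5⟩ |
      ⟨k, k', ρ, b1, b2, b3, b4, b5, b6⟩ | ⟨k, k', ρ, b1, b2, b3, b4, b5, b6⟩)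
  · obtain rfl := outerIdx_inj hR a2 b1 (a4.symm.trans b3)
    exact .inl ⟨_, _, a1, b2, a3, b4, A.trans _ _ _ a5 b5⟩
  · exact absurd (a4.symm.trans b3) (outerIdx_ne_bodyIdx a2 b1)
  · obtain rfl := outerIdx_inj hR a2 b1 (a4.symm.trans b3)
    exact .inr (.inr (.inl ⟨_, _, _, a1, b2, a3, b4, A.trans _ _ _ a5 b5, b6⟩))
  · exact absurd (a4.symm.trans b3) (outerIdx_ne_bodyIdx a2 b1)
  · exact absurd (b3.symm.trans a4) (outerIdx_ne_bodyIdx b1 a2)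
  · obtain rfl := bodyIdx_inj (a4.symm.trans b3)
    exact .inr (.inl ⟨_, _, a1, b2, a3, b4, R.trans _ _ _ a5 b5⟩)
  · exact absurd (b3.symm.trans a4) (outerIdx_ne_bodyIdx b1 a2)
  · obtain rfl := bodyIdx_inj (a4.symm.trans b3)
    exact .inr (.inr (.inr ⟨_, _, _, a1, b2, a3, b4, R.trans _ _ _ a5 b5, b6⟩))
  · exact absurd (b3.symm.trans a4) (outerIdx_ne_bodyIdx b1 a2)
  · obtain rfl := bodyIdx_inj (a4.symm.trans b3)
    exact .inr (.inr (.inl ⟨_, _, _, a1, b2, a3, b4, a5, R.trans _ _ _ a6 b5⟩))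
  · exact absurd (b3.symm.trans a4) (outerIdx_ne_bodyIdx b1 a2)
  · obtain rfl := bodyIdx_inj (a4.symm.trans b3)
    exact .inl ⟨_, _, a1, b2, a3, b4,
      A.trans _ _ _ a5 (A.trans _ _ _ (h2.rel _ _ (R.trans _ _ _ a6 b5)) b6)⟩
  · obtain rfl := outerIdx_inj hR a2 b1 (a4.symm.trans b3)
    exact .inr (.inr (.inr ⟨_, _, _, a1, b2, a3, b4, a5, A.trans _ _ _ a6 b5⟩))
  · exact absurd (a4.symm.trans b3) (outerIdx_ne_bodyIdx a2 b1)
  · obtain rfl := outerIdx_inj hR a2 b1 (a4.symm.trans b3)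
    exact .inr (.inl ⟨_, _, a1, b2, a3, b4,
      R.trans _ _ _ a5 (R.trans _ _ _ (h1.rel _ _ (A.trans _ _ _ a6 b5)) b6)⟩)
  · exact absurd (a4.symm.trans b3) (outerIdx_ne_bodyIdx a2 b1)

/-- A cross equivalence passes through a path `ρ` common to element `j` and the head; since these
have the same paths, an extension on one side exists on the other as well. -/
theorem AMRS.replacePre_rel_append (h1 : A.ElemLE j R (R.len - 1))
    (h2 : R.ElemLE (R.len - 1) A j) {k k' : ℕ} {π π' : List Feat} (α : List Feat)
    (h : (A.replacePre j R hj hR).rel (k, π) (k', π'))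
    (hm : (k, π ++ α) ∈ (A.replacePre j R hj hR).paths) :
    (A.replacePre j R hj hR).rel (k, π ++ α) (k', π' ++ α) := by
  rcases h with ⟨i, i', a1, a2, a3, a4, a5⟩ | ⟨i, i', a1, a2, a3, a4, a5⟩ |
      ⟨i, i', ρ, a1, a2, a3, a4, a5, a6⟩ | ⟨i, i', ρ, a1, a2, a3, a4, a5, a6⟩ <;>
    simp only at a3 a4 <;> subst a3 a4
  · rw [AMRS.replacePre_mem_outer a1] at hm
    exact .inl ⟨_, _, a1, a2, rfl, rfl, A.rel_append a5 α hm⟩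
  · rw [AMRS.replacePre_mem_body a1] at hm
    exact .inr (.inl ⟨_, _, a1, a2, rfl, rfl, R.rel_append a5 α hm⟩)
  · rw [AMRS.replacePre_mem_outer a1] at hm
    have a := A.rel_append a5 α hm
    exact .inr (.inr (.inl ⟨_, _, _, a1, a2, rfl, rfl, a,
      R.rel_append a6 α (h1.paths _ (A.rel_mem _ _ a).2)⟩))
  · rw [AMRS.replacePre_mem_body a1] at hm
    have a := R.rel_append a5 α hm
    exact .inr (.inr (.inr ⟨_, _, _, a1, a2, rfl, rfl, a,
      A.rel_append a6 α (h2.paths _ (R.rel_mem _ _ a).2)⟩))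

/-- Agreement of element `j` and the head in both directions makes the raw replacement closed: cross
equivalences compose, extend along features and respect types. Hence the replacement spreads no
information. -/
theorem AMRS.replace_toPreAMRS (h1 : A.ElemLE j R (R.len - 1)) (h2 : R.ElemLE (R.len - 1) A j) :
    (A.replace j R hj hR).toPreAMRS = A.replacePre j R hj hR := by
  have hty : ∀ π, A.typ (j, π) = R.typ (R.len - 1, π) := fun π =>
    le_antisymm (h1.typ π) (h2.typ π)
  refine PreAMRS.cl_eqv_ty_eq_self _ (A.replacePre_prefixClosed j R hj hR) ?_ ?_ ?_ ?_ ?_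
  · exact fusionClosed_of_append (A.replacePre j R hj hR).rel_mem
      (fun _ _ => AMRS.replacePre_symm)
      fun i π i' π' α h hm => AMRS.replacePre_rel_append h1 h2 α h hm
  · rintro p (⟨i, h, e, h'⟩ | ⟨i, h, e, h'⟩)
    · exact .inl ⟨i, i, h, h, e, e, A.refl _ h'⟩
    · exact .inr (.inl ⟨i, i, h, h, e, e, R.refl _ h'⟩)
  · exact fun _ _ => AMRS.replacePre_symm
  · exact fun _ _ _ => AMRS.replacePre_trans h1 h2
  · rintro ⟨k, π⟩ ⟨k', π'⟩ (⟨i, i', a1, a2, a3, a4, a5⟩ | ⟨i, i', a1, a2, a3, a4, a5⟩ |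
        ⟨i, i', ρ, a1, a2, a3, a4, a5, a6⟩ | ⟨i, i', ρ, a1, a2, a3, a4, a5, a6⟩) <;>
      simp only at a3 a4 <;> subst a3 a4
    · rw [AMRS.replacePre_typ_outer a1, AMRS.replacePre_typ_outer a2, A.typ_rel _ _ a5]
    · rw [AMRS.replacePre_typ_body a1, AMRS.replacePre_typ_body a2, R.typ_rel _ _ a5]
    · rw [AMRS.replacePre_typ_outer a1, AMRS.replacePre_typ_body a2, A.typ_rel _ _ a5, hty,
        R.typ_rel _ _ a6]
    · rw [AMRS.replacePre_typ_body a1, AMRS.replacePre_typ_outer a2, R.typ_rel _ _ a5, ← hty,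
        A.typ_rel _ _ a6]

theorem AMRS.elemLE_replace_outer (h1 : A.ElemLE j R (R.len - 1))
    (h2 : R.ElemLE (R.len - 1) A j) {i : ℕ} (hi : i ≠ j) :
    A.ElemLE i (A.replace j R hj hR) (outerIdx j R.len i) := by
  constructor <;> rw [AMRS.replace_toPreAMRS h1 h2]
  · exact fun π => (AMRS.replacePre_mem_outer hi).2
  · exact fun π π' h => .inl ⟨i, i, hi, hi, rfl, rfl, h⟩
  · exact fun π => (AMRS.replacePre_typ_outer hi π).ge

theorem AMRS.elemLE_replace_body (h1 : A.ElemLE j R (R.len - 1))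
    (h2 : R.ElemLE (R.len - 1) A j) {i : ℕ} (hi : i < R.len - 1) :
    R.ElemLE i (A.replace j R hj hR) (bodyIdx j i) := by
  constructor <;> rw [AMRS.replace_toPreAMRS h1 h2]
  · exact fun π => (AMRS.replacePre_mem_body hi).2
  · exact fun π π' => (AMRS.replacePre_rel_body hi hi).2
  · exact fun π => (AMRS.replacePre_typ_body hi π).ge

theorem AMRS.replace_not_fails (h1 : A.ElemLE j R (R.len - 1)) (h2 : R.ElemLE (R.len - 1) A j)
    (hA : ¬ A.Fails) (hRF : ¬ R.Fails) : ¬ (A.replace j R hj hR).Fails := by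
  unfold AMRS.Fails
  rw [AMRS.replace_toPreAMRS h1 h2]
  rintro ⟨⟨k, π⟩, ⟨i, h, e, h'⟩ | ⟨i, h, e, h'⟩, ht⟩ <;> simp only at e <;> subst e
  · exact AMRS.typ_ne_top hA h' ((AMRS.replacePre_typ_outer h π).symm.trans ht)
  · exact AMRS.typ_ne_top hRF h' ((AMRS.replacePre_typ_body h π).symm.trans ht)

/-! ### Derivation steps -/

theorem AMRS.unify_singleton_eq_self {A B : AMRS Feat Ty} {j : ℕ} (h : B.ElemLE 0 A j) :
    A.unify {j} (fun _ => 0) B = A :=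
  AMRS.unify_eq_self
    (by rintro _ - rfl; exact h.paths)
    (by rintro _ - rfl _ - rfl; exact h.rel)
    (by rintro _ - rfl; exact h.typ)

theorem AMRS.replace_strongDer {θ : Node → Ty} {G : Grammar Node Feat} {ρ : MRS Node Feat}
    (hρ : ρ ∈ G.rules) (hle : ρ.abs θ ≤ R) (h1 : A.ElemLE j R (R.len - 1))
    (h2 : R.ElemLE (R.len - 1) A j) (hA : ¬ A.Fails) (hRF : ¬ R.Fails) :
    StrongDer θ G A (A.replace j R hj hR) := by
  have hB : (A.replace j R hj hR).toPreAMRS = _ := AMRS.replace_toPreAMRS h1 h2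
  have hlen : (A.replace j R hj hR).len = A.len + R.len - 2 := rfl
  have eb : ∀ i, bodyIdx j i = j + i := fun i => Nat.add_comm i j
  have hj' := hj
  -- The body occupies a block that starts at the old index `j`. All four unifications are with
  -- structures already contained in their first argument.
  refine ⟨ρ, hρ, R, hle, j, hj, hR, j, by omega, ⟨?_, hA⟩, ⟨?_, hRF⟩,
    ⟨?_, AMRS.replace_not_fails h1 h2 hA hRF⟩, ⟨?_, hRF⟩, rfl⟩
  · exact (AMRS.unify_singleton_eq_self ((R.elemLE_slice_left _ 1 0).trans h2)).symm
  · exact (AMRS.unify_singleton_eq_self ((A.elemLE_slice_left j 1 0).trans h1)).symm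
  · have hi : ∀ k ∈ Set.Ico j (j + (R.len - 1)), ∃ i < R.len - 1, k = bodyIdx j i := by
      rintro k ⟨h, h'⟩
      exact ⟨k - j, by omega, by rw [eb]; omega⟩
    have hs : ∀ i, bodyIdx j i - j = i := fun i => by rw [eb]; omega
    refine (AMRS.unify_eq_self ?_ ?_ ?_).symm
    · rintro k - hk π h
      obtain ⟨i, hi, rfl⟩ := hi k hk
      rw [hs] at h
      rw [hB, AMRS.replacePre_mem_body hi]
      simpa using h.2
    · rintro k - hk k' - hk' π π' h
      obtain ⟨i, hi, rfl⟩ := hi k hk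
      obtain ⟨i', hi', rfl⟩ := ‹∀ k ∈ Set.Ico j (j + (R.len - 1)), _› k' hk'
      rw [hs, hs] at h
      rw [hB, AMRS.replacePre_rel_body hi hi']
      simpa using h.2.2
    · rintro k - hk π
      obtain ⟨i, hi, rfl⟩ := hi k hk
      rw [hs, hB, AMRS.replacePre_typ_body hi]
      simpa using (R.elemLE_slice_left 0 (R.len - 1) i).typ π
  · refine (AMRS.unify_eq_self ?_ ?_ ?_).symm
    · rintro i - hi π ⟨-, h⟩
      rw [hB] at h
      exact (AMRS.replacePre_mem_body hi).1 (by rw [eb]; exact h)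
    · rintro i - hi i' - hi' π π' ⟨-, -, h⟩
      rw [hB] at h
      exact (AMRS.replacePre_rel_body hi hi').1 (by rw [eb, eb]; exact h)
    · rintro i - hi π
      refine ((AMRS.elemLE_slice_left _ j (R.len - 1) i).typ π).trans ?_
      rw [hB, ← eb, AMRS.replacePre_typ_body hi]

/-- An element above the head of a specialized rule `C` can be expanded to a block above the body
of `C`. -/
theorem exists_strongDer {θ : Node → Ty} {G : Grammar Node Feat} {ρ : MRS Node Feat}
    {A C : AMRS Feat Ty} {j : ℕ} (hρ : ρ ∈ G.rules) (hle : ρ.abs θ ≤ C) (hA : ¬ A.Fails)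
    (hC : ¬ C.Fails) (hj : j < A.len) (hh : C.ElemLE (C.len - 1) A j) :
    ∃ B, StrongDer θ G A B ∧ ¬ B.Fails ∧ B.len + 1 = A.len + (C.len - 1) ∧
      (∀ t < C.len - 1, C.ElemLE t B (j + t)) ∧ (∀ t < j, A.ElemLE t B t) ∧
      ∀ t, j < t → A.ElemLE t B (t + (C.len - 1) - 1) := by
  have hpos : 0 < C.len := hle.1 ▸ G.rules_pos ρ hρ
  have hlt : C.len - 1 < C.len := by omega
  -- `C` itself need not match element `j` exactly, as `hh` is only one inequality; `R` has the
  -- missing information added.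
  let R := C.specialize (C.len - 1) A j hh
  have hCR : C ≤ R := AMRS.le_specialize hh
  have h1 : A.ElemLE j R (R.len - 1) := AMRS.elemLE_specialize hh hlt
  have h2 : R.ElemLE (R.len - 1) A j := AMRS.specialize_elemLE hh
  have hRF : ¬ R.Fails := AMRS.specialize_not_fails hh hC hA
  have hR : 0 < R.len := hpos
  have hlen : (A.replace j R hj hR).len = A.len + C.len - 2 := rfl
  refine ⟨A.replace j R hj hR, AMRS.replace_strongDer hρ ?_ h1 h2 hA hRF,
    AMRS.replace_not_fails h1 h2 hA hRF, by omega, fun t ht => ?_, fun t ht => ?_, fun t ht => ?_⟩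
  · exact ⟨hle.1.trans hCR.1, hle.2.1.trans hCR.2.1, fun p q h => hCR.2.2.1 _ _ (hle.2.2.1 _ _ h),
      fun p hp => (hle.2.2.2 p hp).trans (hCR.2.2.2 p (hle.2.1 hp))⟩
  · have := (AMRS.elemLE_of_le hCR t).trans
      (AMRS.elemLE_replace_body (hj := hj) (hR := hR) h1 h2 ht)
    rwa [bodyIdx, Nat.add_comm] at this
  · have := AMRS.elemLE_replace_outer (hj := hj) (hR := hR) h1 h2 (i := t) (by omega)
    rwa [outerIdx, if_pos ht] at this
  · have := AMRS.elemLE_replace_outer (hj := hj) (hR := hR) h1 h2 (i := t) (by omega)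
    rw [outerIdx, if_neg (by omega)] at this
    have e : t + R.len - 2 = t + (C.len - 1) - 1 := by
      show t + C.len - 2 = _
      omega
    rwa [e] at this

end Soundness

section ItemSoundness

variable {Node Feat Ty Word : Type*} [CompleteLattice Ty]

/-! ### Soundness of items -/

/-- The abstraction of entry `t` of `L` subsumes element `j + t` of `B`, for all `t`. -/
def BlockLE (θ : Node → Ty) (L : List (TFS Node Feat)) (B : AMRS Feat Ty) (j : ℕ) : Prop :=
  ∀ (t : ℕ) (a : TFS Node Feat), L[t]? = some a → (a.abs θ).ElemLE 0 B (j + t)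

/-! ### Concatenations of categories below a block. -/

theorem foldr_concat_len (θ : Node → Ty) (L : List (TFS Node Feat)) :
    ((L.map (TFS.abs θ)).foldr AMRS.concat AMRS.empty).len = L.length := by
  induction L with
  | nil => rfl
  | cons a L ih =>
    show 1 + ((L.map (TFS.abs θ)).foldr AMRS.concat AMRS.empty).len = _
    rw [ih, List.length_cons, Nat.add_comm]

/-- A concatenation has no sharing between its parts, so elementwise bounds suffice even if `B` has
such sharing. The offset `m` varies because the induction removes the first entry. -/
theorem foldr_concat_bounds {θ : Node → Ty} {L : List (TFS Node Feat)} {B : AMRS Feat Ty} :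
    ∀ {m : ℕ}, BlockLE θ L B m →
      let P := (L.map (TFS.abs θ)).foldr AMRS.concat AMRS.empty
      (∀ i π, (i, π) ∈ P.paths → (m + i, π) ∈ B.paths) ∧
      (∀ i π i' π', P.rel (i, π) (i', π') → B.rel (m + i, π) (m + i', π')) ∧
      ∀ i π, P.typ (i, π) ≤ B.typ (m + i, π) := by
  induction L with
  | nil => exact fun _ => ⟨fun _ _ h => h.elim, fun _ _ _ _ h => h.elim, fun _ _ => bot_le⟩
  | cons a L ih =>
    intro m h
    have h0 : (a.abs θ).ElemLE 0 B m := h 0 a rfl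
    have hL : BlockLE θ L B (m + 1) := fun t b hb => by
      have := h (t + 1) b (by simpa using hb)
      rwa [show m + (t + 1) = m + 1 + t by omega] at this
    have hz : ∀ {p}, p ∈ (a.abs θ).paths → p.1 = 0 := fun hp =>
      Nat.lt_one_iff.1 ((a.abs θ).idx_lt _ hp)
    have e : ∀ {i}, 1 ≤ i → m + 1 + (i - 1) = m + i := fun hi => by omega
    obtain ⟨b1, b2, b3⟩ := ih hL
    refine ⟨?_, ?_, ?_⟩
    · rintro i π (hp | ⟨hi, hp⟩)
      · obtain rfl : i = 0 := hz hp
        exact h0.paths π hp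
      · have := b1 _ _ hp
        change (m + 1 + (i - 1), π) ∈ _ at this
        rwa [e hi] at this
    · rintro i π i' π' (hr | ⟨hi, hi', hr⟩)
      · obtain rfl : i = 0 := hz ((a.abs θ).rel_mem _ _ hr).1
        obtain rfl : i' = 0 := hz ((a.abs θ).rel_mem _ _ hr).2
        exact h0.rel π π' hr
      · have := b2 _ _ _ _ hr
        change B.rel (m + 1 + (i - 1), π) (m + 1 + (i' - 1), π') at this
        rwa [e hi, e hi'] at this
    · intro i π
      simp only [List.map_cons, List.foldr_cons]
      unfold AMRS.concat
      dsimp only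
      split_ifs with hi
      · obtain rfl : i = 0 := Nat.lt_one_iff.1 hi
        exact h0.typ π
      · have h1 : 1 ≤ i := Nat.not_lt.1 hi
        have := b3 (i - 1) π
        rw [e h1] at this
        exact this

theorem foldr_concat_le {θ : Node → Ty} {L : List (TFS Node Feat)} {B : AMRS Feat Ty}
    (hlen : B.len = L.length) (h : BlockLE θ L B 0) :
    (L.map (TFS.abs θ)).foldr AMRS.concat AMRS.empty ≤ B := by
  obtain ⟨h1, h2, h3⟩ := foldr_concat_bounds h
  simp only [Nat.zero_add] at h1 h2 h3
  exact ⟨(foldr_concat_len θ L).trans hlen.symm, fun p hp => h1 _ _ hp,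
    fun p q hr => h2 _ _ _ _ hr, fun p _ => h3 _ _⟩

/-- Whenever a block of a consistent structure is subsumed, element by element, by the structure
of the item, that block derives the pre-terminals of the part of the word spanned by the item,
and the elements around the block lose no information. -/
def Item.Sound (θ : Node → Ty) (Cat : Word → Set (TFS Node Feat)) (G : Grammar Node Feat)
    (w : List Word) (x : Item Feat Ty) : Prop :=
  ∀ (A : AMRS Feat Ty) (j : ℕ), ¬ A.Fails → j + x.A.len ≤ A.len →
    (∀ t < x.A.len, x.A.ElemLE t A (j + t)) →
    ∃ (B : AMRS Feat Ty) (L : List (TFS Node Feat)),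
      Relation.ReflTransGen (StrongDer θ G) A B ∧ ¬ B.Fails ∧
      List.Forall₂ (fun y a => a ∈ Cat y) ((w.drop x.i).take (x.j - x.i)) L ∧
      B.len + x.A.len = A.len + L.length ∧ BlockLE θ L B j ∧
      (∀ t < j, A.ElemLE t B t) ∧
      ∀ t, j + x.A.len ≤ t → A.ElemLE t B (t + L.length - x.A.len)

/-! ### Preservation of the invariant by the parsing operations. -/

variable {θ : Node → Ty} {Cat : Word → Set (TFS Node Feat)} {G : Grammar Node Feat}
  {w : List Word}

theorem DotMove.sound {I : Set (Item Feat Ty)} (hI : ∀ y ∈ I, y.Sound θ Cat G w)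
    {x : Item Feat Ty} (h : DotMove θ G I x) : x.Sound θ Cat G w := by
  obtain ⟨ρ, hρ, hm, k, hk, α, hα, -, hαk, β, hβ, -, hβ1, hαβ, B₀, C, ⟨hB₀, -⟩, ⟨hC, -⟩, hxi, hxA,
    hxj, -⟩ := h
  have hlenB : B₀.len = (ρ.abs θ).len := by rw [hB₀]; rfl
  have hlenC : C.len = (ρ.abs θ).len := by rw [hC, ← hlenB]; rfl
  have hxlen : x.A.len = k + 1 := by
    rw [hxA]
    show min (k + 1) (C.len - 0) = _
    omega
  have hCx : ∀ t < k + 1, C.ElemLE t x.A t := fun t ht => by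
    have := C.elemLE_slice_right 0 ht
    rwa [Nat.zero_add, ← hxA] at this
  have hαx : ∀ t < k, α.A.ElemLE t x.A t := fun t ht => by
    have h1 : α.A.ElemLE t B₀ t := hB₀ ▸ (ρ.abs θ).elemLE_unify id α.A (by omega) ht
    have h2 : B₀.ElemLE t C t := hC ▸ AMRS.elemLE_of_le (B₀.le_unify _ _ _) t
    exact (h1.trans h2).trans (hCx t (by omega))
  have hβx : β.A.ElemLE 0 x.A k := by
    have h1 : β.A.ElemLE 0 C k :=
      hC ▸ B₀.elemLE_unify (fun _ => 0) β.A (i := k) (by omega) (Set.mem_singleton k)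
    exact h1.trans (hCx k (by omega))
  intro A j hA hj hle
  rw [hxlen] at hj hle ⊢
  obtain ⟨B, L, hd, hBF, hL, hlen, hblock, hleft, hright⟩ := hI α hα A j hA (by omega)
    fun t ht => (hαx t (by omega)).trans (hle t (by omega))
  rw [hαk] at hlen hright
  -- Rewriting the first `k` elements has moved element `j + k` to `j + L.length`, where it is still
  -- above `β.A`.
  obtain ⟨B', L', hd', hBF', hL', hlen', hblock', hleft', hright'⟩ := hI β hβ B (j + L.length) hBF
    (by omega) fun t ht => by
      obtain rfl : t = 0 := by omega
      have := (hβx.trans (hle k (by omega))).trans (hright (j + k) le_rfl)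
      rwa [show j + k + L.length - k = j + L.length + 0 by omega] at this
  rw [hβ1] at hlen' hright'
  refine ⟨B', L ++ L', hd.trans hd', hBF', ?_, ?_, ?_, fun t ht => ?_, fun t ht => ?_⟩
  · have e : (w.drop x.i).take (x.j - x.i) =
        (w.drop α.i).take (α.j - α.i) ++ (w.drop β.i).take (β.j - β.i) := by
      have h1 := α.le
      have h2 := β.le
      rw [hxi, hxj, show β.j - α.i = (α.j - α.i) + (β.j - β.i) by omega, List.take_add,
        List.drop_drop, show α.i + (α.j - α.i) = β.i by omega]
    rw [e]
    exact List.rel_append hL hL'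
  · rw [List.length_append]
    omega
  · intro t a ht
    by_cases htL : t < L.length
    · rw [List.getElem?_append_left htL] at ht
      exact (hblock t a ht).trans (hleft' _ (by omega))
    · rw [List.getElem?_append_right (by omega)] at ht
      have := hblock' _ a ht
      rwa [show j + L.length + (t - L.length) = j + t by omega] at this
  · exact (hleft t ht).trans (hleft' t (by omega))
  · have := (hright t (by omega)).trans (hright' (t + L.length - k) (by omega))
    rwa [show t + L.length - k + L'.length - 1 = t + (L ++ L').length - (k + 1) by
      rw [List.length_append]; omega] at this

/-- The derivation first expands the head and then rewrites the new body. The item has forgotten the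
body of `C`, but the expansion restores it, and `α.A` is below it elementwise. -/
theorem Complete.sound {I : Set (Item Feat Ty)} (hI : ∀ y ∈ I, y.Sound θ Cat G w)
    {x : Item Feat Ty} (h : Complete θ G I x) : x.Sound θ Cat G w := by
  obtain ⟨ρ, hρ, hm, α, hα, -, hαk, C, ⟨hC, hCF⟩, hxi, hxA, hxj, -⟩ := h
  have hle : ρ.abs θ ≤ C := hC ▸ (ρ.abs θ).le_unify _ _ _
  have hlenC : C.len = (ρ.abs θ).len := hle.1.symm
  have hxlen : x.A.len = 1 := by
    rw [hxA]
    show min 1 (C.len - _) = _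
    omega
  have hCx : C.ElemLE (C.len - 1) x.A 0 := by
    have := C.elemLE_slice_right (C.len - 1) Nat.zero_lt_one
    rwa [Nat.add_zero, hlenC, ← hxA, ← hlenC] at this
  have hαC : ∀ t < C.len - 1, α.A.ElemLE t C t := fun t ht =>
    hC ▸ (ρ.abs θ).elemLE_unify id α.A (i := t) (by omega) (Set.mem_Iio.2 (by omega))
  intro A j hA hj hxle
  rw [hxlen] at hj hxle ⊢
  obtain ⟨B, hd, hBF, hlen, hbody, hleft, hright⟩ :=
    exists_strongDer hρ hle hA hCF (by omega) (hCx.trans (hxle 0 Nat.zero_lt_one))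
  obtain ⟨B', L, hd', hBF', hL, hlen', hblock, hleft', hright'⟩ := hI α hα B j hBF (by omega)
    fun t ht => (hαC t (by omega)).trans (hbody t (by omega))
  refine ⟨B', L, .head hd hd', hBF', by rwa [hxi, hxj], by omega, hblock,
    fun t ht => (hleft t ht).trans (hleft' t ht), fun t ht => ?_⟩
  have := (hright t (by omega)).trans (hright' (t + (C.len - 1) - 1) (by omega))
  rwa [show t + (C.len - 1) - 1 + L.length - α.A.len = t + L.length - 1 by omega] at this

theorem Item.sound_empty (i : ℕ) :
    (⟨i, AMRS.empty, i, .act, le_rfl⟩ : Item Feat Ty).Sound θ Cat G w :=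
  fun A _ hA _ _ => ⟨A, [], .refl, hA, by simp, rfl, fun _ _ h => by simp at h,
    fun t _ => .refl A t, fun t _ => .refl A t⟩

theorem Item.sound_rule {ρ : MRS Node Feat} (hρ : ρ ∈ G.rules) (h1 : (ρ.abs θ).len = 1) (i : ℕ) :
    (⟨i, ρ.abs θ, i, .comp, le_rfl⟩ : Item Feat Ty).Sound θ Cat G w := by
  intro A j hA hj hle
  simp only [h1] at hj hle ⊢
  have h0 := hle 0 Nat.zero_lt_one
  -- Here the rule is not the result of a successful unification; as it consists of its head alone,
  -- its consistency follows from that of `A`.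
  have hF : ¬ (ρ.abs θ).Fails := by
    rintro ⟨⟨k, π⟩, hp, ht⟩
    have hk := (ρ.abs θ).idx_lt _ hp
    obtain rfl : k = 0 := by simp only [h1] at hk; omega
    exact AMRS.typ_ne_top hA (h0.paths π hp) (top_le_iff.1 (ht ▸ h0.typ π))
  obtain ⟨B, hd, hBF, hlen, -, hleft, hright⟩ :=
    exists_strongDer (C := ρ.abs θ) (j := j) hρ
      ⟨rfl, subset_rfl, fun _ _ h => h, fun _ _ => le_rfl⟩ hA hF (by omega) (by rwa [h1])
  rw [h1] at hlen hright
  exact ⟨B, [], .single hd, hBF, by simp, hlen, fun _ _ h => by simp at h, hleft,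
    fun t ht => hright t ht⟩

theorem Item.sound_scan {i : ℕ} (hi : i < w.length) {a : TFS Node Feat} (ha : a ∈ Cat w[i]) :
    (⟨i, a.abs θ, i + 1, .comp, Nat.le_succ i⟩ : Item Feat Ty).Sound θ Cat G w := by
  intro A j hA _ hle
  refine ⟨A, [a], .refl, hA, ?_, rfl, ?_, fun t _ => .refl A t, fun t _ => .refl A t⟩
  · simp only [Nat.add_sub_cancel_left, List.drop_eq_getElem_cons hi]
    exact .cons ha .nil
  · intro t b hb
    rcases t with _ | t
    · obtain rfl : a = b := by simpa using hb
      exact hle 0 Nat.zero_lt_one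
    · simp at hb

theorem computation_sound (m : ℕ) :
    ∀ x ∈ computation θ Cat G w m, x.Sound θ Cat G w := by
  induction m with
  | zero => exact fun x h => h.elim
  | succ m ih =>
    rintro x (h | h | ⟨i, -, rfl⟩ | ⟨ρ, hρ, h1, i, -, rfl⟩ | ⟨i, hi, a, ha, rfl⟩)
    · exact h.sound ih
    · exact h.sound ih
    · exact Item.sound_empty i
    · exact Item.sound_rule hρ h1 i
    · exact Item.sound_scan hi ha

end ItemSoundness

/-! ### From a successful computation to membership in the language. -/

theorem mainTheorem8 {Node Feat Ty Word : Type*} [CompleteLattice Ty] [Finite Ty] [Finite Feat]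
    (θ : Node → Ty) (Cat : Word → Set (TFS Node Feat)) (G : Grammar Node Feat) (w : List Word)
    (h : Successful θ Cat G w) : w ∈ language θ Cat G := by
  obtain ⟨m, x, hx, hi, hj, -, hlen, A, hA, hAF⟩ := h
  have hxA : x.A ≤ A := hA ▸ x.A.le_unify _ _ _
  have hAlen : A.len = 1 := hxA.1.symm.trans hlen
  have hs : (G.start.abs θ).ElemLE 0 A 0 :=
    hA ▸ x.A.elemLE_unify (fun _ => 0) _ (i := 0) (by omega) (Set.mem_singleton 0)
  have hsA : G.start.abs θ ≤ A := by
    have hz : ∀ p ∈ (G.start.abs θ).paths, p.1 = 0 := fun p hp =>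
      Nat.lt_one_iff.1 ((G.start.abs θ).idx_lt p hp)
    refine ⟨hAlen.symm, ?_, ?_, ?_⟩
    · rintro ⟨i, π⟩ hp
      obtain rfl : i = 0 := hz _ hp
      exact hs.paths π hp
    · rintro ⟨i, π⟩ ⟨i', π'⟩ hr
      obtain rfl : i = 0 := hz _ ((G.start.abs θ).rel_mem _ _ hr).1
      obtain rfl : i' = 0 := hz _ ((G.start.abs θ).rel_mem _ _ hr).2
      exact hs.rel π π' hr
    · rintro ⟨i, π⟩ hp
      obtain rfl : i = 0 := hz _ hp
      exact hs.typ π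
  -- The block is all of `A`, so its result is compared with the pre-terminals of the whole word.
  obtain ⟨B, L, hd, -, hL, hBlen, hblock, -⟩ := computation_sound m x hx A 0 hAF (by omega)
    fun t _ => by
      rw [Nat.zero_add]
      exact AMRS.elemLE_of_le hxA t
  -- `A` serves as `A'`: being above the start symbol, it is its own unification with it.
  refine ⟨_, ⟨L, ?_, rfl⟩, A, B, hAlen, ⟨A, (AMRS.unify_iio_eq_right hsA).symm, hAF⟩,
    foldr_concat_le (by omega) hblock, hd⟩
  simpa [hi, hj] using hL
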